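/- **Setting.** Let $1\le n\le p$, $X=[X_1|\cdots|X_p]\in\mathbb R^{n\times p}$, $\beta_0\in\mathbb R^p$, $\lambda>0$, $\alpha\in(1,\infty)$, and let $\alpha^*$ be the conjugate exponent, $\rho=\alpha^*/\alpha$, $\eta(x)=\mathrm{sgn}(x)|x|^\rho$, $\eta^{-1}(x)=\mathrm{sgn}(x)|x|^{1/\rho}$, $\eta'(x)=\rho|x|^{\rho-1}$ (with the convention $\eta'(0)=0$ if $\rho<1$), all applied entrywise to vectors. Let $\mathcal G_1,\dots,\mathcal G_J$ be a partition of $\{1,\dots,p\}$ into groups; write $v_{(j)}=(v_k)_{k\in\mathcal G_j}$, $N_{(j)}$ for the columns of a matrix $N$ in $\mathcal G_j$, and $G(v)=\{j: v_{(j)}\ne0\}$. Let $w_1,\dots,w_J>0$, let $W$ be the diagonal matrix with entry $w_j$ at the indices in $\mathcal G_j$, let $\Psi=\frac1nX^{\mathsf T}X$, and let $N^+$ be the Moore-Penrose pseudo-inverse of $N$. Let $y=X\beta_0+\varepsilon$, where $\varepsilon$ is a random vector in $\mathbb R^n$ such that $\varepsilon/\sqrt n$ has a density $g_n$ with respect to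 Lebesgue measure. An augmented solution for $y$ is a pair $(\hat\beta,S)$ such that $\hat\beta$ minimizes $\frac1{2n}\|y-X\beta\|_2^2+\lambda\sum_j w_j\|\beta_{(j)}\|_\alpha$, $S_{(j)}=\eta^{-1}(\hat\beta_{(j)}/\|\hat\beta_{(j)}\|_\alpha)$ if $\hat\beta_{(j)}\neq0$ and $\|S_{(j)}\|_{\alpha^*}\le1$ if $\hat\beta_{(j)}=0$, and $\Psi\hat\beta+\lambda WS=\frac1nX^{\mathsf T}y$. Put $\hat\gamma_j=\|\hat\beta_{(j)}\|_\alpha$ and $\mathcal A=G(\hat\beta)$; the augmented estimator is $(\hat\gamma_{\mathcal A},S,\mathcal A)$. **Assumptions.** (1) Every $\min(n,p)$ columns of $X$ are linearly independent. (2) (a) $|\mathcal G_j|\le n$ for all $j$. (b) For every $s$ in $\mathcal V$, the row space of $XW^{-1}$, the vectors $w_j^{-1}X_{(j)}\eta(s_{(j)})\in\mathbb R^n$ over all $j$ with $\|s_{(j)}\|_{\alpha^*}=1$ are in general position, i.e. any $n+1$ or fewer of them are affinely independent. **Notation.** For $A\subset\{1,\dots,J\}$ with $|A|\le n$ let $k=n-|A|$,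 let $\mathcal M_A$ be the set of $s\in\mathcal V$ with $\|s_{(j)}\|_{\alpha^*}=1$ for $j\in A$ and $\|s_{(j)}\|_{\alpha^*}\le1$ for $j\notin A$, and let $\Omega_A=(0,\infty)^{A}\times\mathcal M_A$. The tangent space $\mathcal T_s$ of $\mathcal M_A$ at $s$ consists of the $d\in\mathcal V$ with $\langle\eta(s_{(j)}),d_{(j)}\rangle=0$ for all $j\in A$. A set $F$ of $k$ indices is a system of local coordinates at $s$ if $d\mapsto d_F$ is a bijection from $\mathcal T_s$ onto $\mathbb R^k$; $T\in\mathbb R^{p\times k}$ is then the matrix of the inverse bijection (so $ds=T\,ds_F$). For $(r_A,s)\in\Omega_A$, with $r_j=0$ for $j\notin A$, put $$\tilde H_A(r_A,s)=\sqrt n\,(X^{\mathsf T})^+\Big(\sum_{j\in A}r_j\Psi_{(j)}\eta(s_{(j)})+\lambda Ws-\Psi\beta_0\Big),$$ $$M=\Big[\big(\Psi_{(j)}\eta(s_{(j)})\big)_{j\in A}\;\Big|\;\big\{[r_1\Psi_{(1)}|\cdots|r_J\Psi_{(J)}]\,D+\lambda W\big\}T\Big]\in\mathbb R^{p\times n},\qquad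 J_A=\det\big[\sqrt n\,(X^{\mathsf T})^+M\big],$$ where $D$ is diagonal with $D_{ll}=\eta'(s_l)$ if $l$ lies in a group $\mathcal G_j$ with $j\in A$ and $D_{ll}=0$ otherwise. **Theorem.** Under Assumptions (1) and (2), there is exactly one augmented solution for every $y\in\mathbb R^n$, so that the augmented estimator is well defined; $(\hat\beta,S)$ is a random vector, and always $|\mathcal A|\le n$ and $S\in\mathcal M_{\mathcal A}$. If $|A|\le n$, each point of $\mathcal M_A$ has a neighbourhood in $\mathcal M_A$ that is parameterized by $k$ of the coordinates, $s_F$. The distribution of the augmented estimator is given on each $\Omega_A$ by the $n$-form $$d\mu_A=g_n\big(\tilde H_A(r_A,s)\big)\,|J_A(r_A,s)|\,d\theta,\qquad\theta=(r_A,s_F),$$ that is: for every measurable $\Gamma\subset(0,\infty)^A$, every measurable $\Delta\subset\mathbb R^k$, every one-to-one differentiable parameterization $\Phi:\Delta\to\mathcal M_A$, and any choice of local coordinates $F=F(u)$ at $\Phi(u)$, $u\in\Delta$ (supposed to exist at each $\Phi(u)$), $$\mathbb P\big(\hat\gamma_A\in\Gamma,\ S\in\Phi(\Delta),\ \mathcal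 A=A\big)=\int_\Gamma\int_\Delta g_n\big(\tilde H_A(r_A,\Phi(u))\big)\,|J_A(r_A,\Phi(u))|\,\Big|\det\frac{\partial s_F}{\partial u}\Big|\,du\,dr_A .$$ In particular the last factor is $1$ if $\Phi$ is a parameterization by $s_F$. -/

import Mathlib

open Matrix MeasureTheory
open scoped ENNReal

noncomputable section

namespace BlockLasso

/-! ### Linear algebra: Moore-Penrose pseudo-inverse and general position -/

/-- `P` satisfies the four Penrose equations for the real matrix `M`. -/
structure IsMoorePenrose {m n : ℕ} (M : Matrix (Fin m) (Fin n) ℝ)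
    (P : Matrix (Fin n) (Fin m) ℝ) : Prop where
  mul_mul_left : M * P * M = M
  mul_mul_right : P * M * P = P
  symm_left : (M * P)ᵀ = M * P
  symm_right : (P * M)ᵀ = P * M

/-- The Penrose equations have at most one solution. -/
theorem IsMoorePenrose.unique {m n : ℕ} {M : Matrix (Fin m) (Fin n) ℝ}
    {P Q : Matrix (Fin n) (Fin m) ℝ} (hP : IsMoorePenrose M P) (hQ : IsMoorePenrose M Q) :
    P = Q := by
  have h1 : M * P = M * Q := by
    calc M * P = (M * P)ᵀ := hP.symm_left.symm
      _ = ((M * Q) * (M * P))ᵀ := by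
          rw [Matrix.mul_assoc M Q, ← Matrix.mul_assoc Q M P, ← Matrix.mul_assoc M (Q * M) P,
            ← Matrix.mul_assoc M Q M, hQ.mul_mul_left]
      _ = (M * P)ᵀᵀ.transpose * (M * Q)ᵀ := by rw [Matrix.transpose_mul, transpose_transpose]
      _ = (M * P) * (M * Q) := by rw [transpose_transpose, hP.symm_left, hQ.symm_left]
      _ = M * Q := by rw [← Matrix.mul_assoc, hP.mul_mul_left]
  have h2 : P * M = Q * M := by
    calc P * M = (P * M)ᵀ := hP.symm_right.symm
      _ = ((P * M) * (Q * M))ᵀ := by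
          rw [Matrix.mul_assoc P M, ← Matrix.mul_assoc M Q M, hQ.mul_mul_left]
      _ = (Q * M) * (P * M) := by rw [Matrix.transpose_mul, hQ.symm_right, hP.symm_right]
      _ = Q * M := by rw [Matrix.mul_assoc Q M, ← Matrix.mul_assoc M P M, hP.mul_mul_left]
  calc P = P * M * P := hP.mul_mul_right.symm
    _ = Q * M * P := by rw [h2]
    _ = Q * M * Q := by rw [Matrix.mul_assoc, h1, ← Matrix.mul_assoc]
    _ = Q := hQ.mul_mul_right

/-- The Moore-Penrose pseudo-inverse `M⁺`. -/
def pinv {m n : ℕ} (M : Matrix (Fin m) (Fin n) ℝ) : Matrix (Fin n) (Fin m) ℝ :=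
  Classical.epsilon (IsMoorePenrose M)

/-- The row space of a matrix. -/
def rowSpace {n p : ℕ} (M : Matrix (Fin n) (Fin p) ℝ) : Submodule ℝ (Fin p → ℝ) :=
  Submodule.span ℝ (Set.range M.row)

/-- A family of vectors of `ℝⁿ` is in general position: for `k < n`, no `k`-dimensional affine
subspace contains `k + 2` of them; that is, any `n + 1` or fewer are affinely independent. -/
def InGeneralPosition {n : ℕ} {ι : Type*} (v : ι → Fin n → ℝ) : Prop :=
  ∀ I : Finset ι, I.card ≤ n + 1 → AffineIndependent ℝ (fun i : I => v i)

/-! ### The block Lasso and its augmented solutions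

The predictors `Fin p` are partitioned into the groups `{k | grp k = j}`, `j : Fin J`. -/

/-- `α* / α`, where `α*` is conjugate to `α`. -/
def rho (α : ℝ) : ℝ := Real.conjExponent α / α

/-- `η(x) = sgn(x) |x| ^ ρ`. -/
def eta (α x : ℝ) : ℝ := Real.sign x * |x| ^ rho α

/-- The inverse function `η⁻¹(x) = sgn(x) |x| ^ (1 / ρ)`. -/
def etaInv (α x : ℝ) : ℝ := Real.sign x * |x| ^ (1 / rho α)

/-- `η'(x) = ρ |x| ^ (ρ - 1)`. If `ρ < 1`, where `η` has no derivative at `0`, this is `0` at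
`x = 0`. -/
def etaDeriv (α x : ℝ) : ℝ := rho α * |x| ^ (rho α - 1)

section Model

variable {n p J : ℕ}

/-- The `ℓ_q` norm of the block `v_(j)`. -/
def blockNorm (grp : Fin p → Fin J) (q : ℝ) (v : Fin p → ℝ) (j : Fin J) : ℝ :=
  (∑ k with grp k = j, |v k| ^ q) ^ (1 / q)

/-- The set `G(v)` of active groups of `v`. -/
def activeGroups (grp : Fin p → Fin J) (v : Fin p → ℝ) : Finset (Fin J) :=
  open Classical in Finset.univ.filter fun j => ∃ k, grp k = j ∧ v k ≠ 0

/-- The diagonal matrix `W` of weights. -/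
def weightMatrix (grp : Fin p → Fin J) (w : Fin J → ℝ) : Matrix (Fin p) (Fin p) ℝ :=
  Matrix.diagonal fun k => w (grp k)

/-- The Gram matrix `Ψ = XᵀX / n`. -/
def gram (X : Matrix (Fin n) (Fin p) ℝ) : Matrix (Fin p) (Fin p) ℝ :=
  (1 / (n : ℝ)) • (Xᵀ * X)

/-- The penalized loss. -/
def loss (X : Matrix (Fin n) (Fin p) ℝ) (grp : Fin p → Fin J) (w : Fin J → ℝ) (α lam : ℝ)
    (y : Fin n → ℝ) (β : Fin p → ℝ) : ℝ :=
  1 / (2 * (n : ℝ)) * ∑ i, (y i - (X *ᵥ β) i) ^ 2 + lam * ∑ j, w j * blockNorm grp α β j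

/-- `(β, S)` is an augmented solution for the response `y`: `β` minimizes the penalized loss,
each block of `S` is a subgradient of the block norm at the corresponding block of `β`, and
the KKT equation `XᵀXβ / n + λ W S = Xᵀy / n` holds. -/
structure IsAugmentedSolution (X : Matrix (Fin n) (Fin p) ℝ) (grp : Fin p → Fin J)
    (w : Fin J → ℝ) (α lam : ℝ) (y : Fin n → ℝ) (β S : Fin p → ℝ) : Prop where
  isMin : ∀ b, loss X grp w α lam y β ≤ loss X grp w α lam y b
  subgrad_active : ∀ j ∈ activeGroups grp β, ∀ k, grp k = j →
    S k = etaInv α (β k / blockNorm grp α β j)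
  subgrad_inactive : ∀ j ∉ activeGroups grp β, blockNorm grp (Real.conjExponent α) S j ≤ 1
  kkt : gram X *ᵥ β + lam • (weightMatrix grp w *ᵥ S) = (1 / (n : ℝ)) • (Xᵀ *ᵥ y)

/-! ### Assumptions on the design -/

/-- Every `min n p` columns of `X` are linearly independent. -/
def ColumnsIndependent (X : Matrix (Fin n) (Fin p) ℝ) : Prop :=
  ∀ I : Finset (Fin p), I.card = min n p → LinearIndependent ℝ (fun k : I => X.col k)

/-- The columns of `M` are in blockwise general position with respect to the groups and `α`:
for every `s` in the row space of `M`, the vectors `M_(j) η(s_(j))`, over the `j` with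
`‖s_(j)‖_{α*} = 1`, are in general position. -/
def BlockwiseGeneralPosition (M : Matrix (Fin n) (Fin p) ℝ) (grp : Fin p → Fin J)
    (α : ℝ) : Prop :=
  ∀ s ∈ rowSpace M, InGeneralPosition
    (fun (j : {j : Fin J // blockNorm grp (Real.conjExponent α) s j = 1}) (i : Fin n) =>
      ∑ k with grp k = j.1, M i k * eta α (s k))

/-! ### The sample space -/

/-- `𝒱`, the row space of `X W⁻¹`. -/
def subgradSpace (X : Matrix (Fin n) (Fin p) ℝ) (grp : Fin p → Fin J) (w : Fin J → ℝ) :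
    Submodule ℝ (Fin p → ℝ) :=
  rowSpace (X * (weightMatrix grp w)⁻¹)

/-- `M_A`, the space of the subgradient vector when `A` is the set of active groups. -/
def subgradManifold (X : Matrix (Fin n) (Fin p) ℝ) (grp : Fin p → Fin J) (w : Fin J → ℝ)
    (α : ℝ) (A : Finset (Fin J)) : Set (Fin p → ℝ) :=
  {s | s ∈ subgradSpace X grp w ∧
    (∀ j ∈ A, blockNorm grp (Real.conjExponent α) s j = 1) ∧
    (∀ j ∉ A, blockNorm grp (Real.conjExponent α) s j ≤ 1)}

/-- The vectors `ds` in `𝒱` with `⟨η(s_(j)), ds_(j)⟩ = 0` for all `j ∈ A`: the tangent space of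
`M_A` at `s`. -/
def tangentSet (X : Matrix (Fin n) (Fin p) ℝ) (grp : Fin p → Fin J) (w : Fin J → ℝ)
    (α : ℝ) (A : Finset (Fin J)) (s : Fin p → ℝ) : Set (Fin p → ℝ) :=
  {d | d ∈ subgradSpace X grp w ∧ ∀ j ∈ A, ∑ k with grp k = j, eta α (s k) * d k = 0}

/-- `ds = T ds_F` on the tangent space of `M_A` at `s`, where the entries of `ds_F` are free. So
`s_F` is a system of local coordinates of `M_A` at `s`, and `T = T(η(s), A)`. -/
structure IsTangentMatrix (X : Matrix (Fin n) (Fin p) ℝ) (grp : Fin p → Fin J)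
    (w : Fin J → ℝ) (α : ℝ) (A : Finset (Fin J)) (s : Fin p → ℝ)
    (F : Fin (n - A.card) ↪ Fin p) (T : Matrix (Fin p) (Fin (n - A.card)) ℝ) : Prop where
  mem : ∀ c, T *ᵥ c ∈ tangentSet X grp w α A s
  free : ∀ c l, (T *ᵥ c) (F l) = c l
  eq : ∀ d ∈ tangentSet X grp w α A s, d = T *ᵥ (fun l => d (F l))

/-- `Φ`, with derivative `Φ'`, is a one-to-one parameterization by the domain `Δ ⊆ ℝᵏ`,
`k = n - |A|`, of a piece `Φ(Δ)` of `M_A`. -/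
structure IsParameterization (X : Matrix (Fin n) (Fin p) ℝ) (grp : Fin p → Fin J)
    (w : Fin J → ℝ) (α : ℝ) (A : Finset (Fin J)) (Δ : Set (Fin (n - A.card) → ℝ))
    (Φ : (Fin (n - A.card) → ℝ) → Fin p → ℝ)
    (Φ' : (Fin (n - A.card) → ℝ) → (Fin (n - A.card) → ℝ) →L[ℝ] (Fin p → ℝ)) : Prop where
  measurableSet : MeasurableSet Δ
  injOn : Set.InjOn Φ Δ
  mapsTo : Set.MapsTo Φ Δ (subgradManifold X grp w α A)
  hasFDerivWithinAt : ∀ u ∈ Δ, HasFDerivWithinAt Φ (Φ' u) Δ u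

/-- The Jacobian `∂s_F / ∂u` at `u` of a parameterization with derivative `L` at `u`. -/
def coordJacobian {k : ℕ} (F : Fin k ↪ Fin p) (L : (Fin k → ℝ) →L[ℝ] (Fin p → ℝ)) : ℝ :=
  ((LinearMap.toMatrix' (L : (Fin k → ℝ) →ₗ[ℝ] (Fin p → ℝ))).submatrix F id).det

/-! ### The mapping and its Jacobian -/

/-- `Ψ∘η = [Ψ_(1) η(s_(1)) | ⋯ | Ψ_(J) η(s_(J))]`. -/
def gramEta (X : Matrix (Fin n) (Fin p) ℝ) (grp : Fin p → Fin J) (α : ℝ) (s : Fin p → ℝ) :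
    Matrix (Fin p) (Fin J) ℝ :=
  Matrix.of fun i j => ∑ k with grp k = j, gram X i k * eta α (s k)

/-- The vector `r ∈ ℝᴶ` that extends `r_A` by `0`. -/
def extendZero (A : Finset (Fin J)) (r : A → ℝ) (j : Fin J) : ℝ :=
  if h : j ∈ A then r ⟨j, h⟩ else 0

/-- `r∘Ψ = [r₁ Ψ_(1) | ⋯ | r_J Ψ_(J)]`. -/
def scaledGram (X : Matrix (Fin n) (Fin p) ℝ) (grp : Fin p → Fin J) (A : Finset (Fin J))
    (r : A → ℝ) : Matrix (Fin p) (Fin p) ℝ :=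
  Matrix.of fun i k => extendZero A r (grp k) * gram X i k

/-- The diagonal matrix `D(s, A)`. -/
def derivMatrix (grp : Fin p → Fin J) (α : ℝ) (A : Finset (Fin J)) (s : Fin p → ℝ) :
    Matrix (Fin p) (Fin p) ℝ :=
  Matrix.diagonal fun k => if grp k ∈ A then etaDeriv α (s k) else 0

/-- `H_A(r_A, s) = ∑_{j ∈ A} r_j Ψ_(j) η(s_(j)) + λ W s - Ψ β₀`. -/
def mapH (X : Matrix (Fin n) (Fin p) ℝ) (grp : Fin p → Fin J) (w : Fin J → ℝ)
    (α lam : ℝ) (β₀ : Fin p → ℝ) (A : Finset (Fin J)) (r : A → ℝ) (s : Fin p → ℝ) :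
    Fin p → ℝ :=
  (∑ j : A, r j • (gramEta X grp α s).col j) + lam • (weightMatrix grp w *ᵥ s) - gram X *ᵥ β₀

/-- `H̃_A = √n (Xᵀ)⁺ H_A`. -/
def mapHTilde (X : Matrix (Fin n) (Fin p) ℝ) (grp : Fin p → Fin J) (w : Fin J → ℝ)
    (α lam : ℝ) (β₀ : Fin p → ℝ) (A : Finset (Fin J)) (r : A → ℝ) (s : Fin p → ℝ) :
    Fin n → ℝ :=
  √(n : ℝ) • (pinv Xᵀ *ᵥ mapH X grp w α lam β₀ A r s)

/-- `M(r_A, s, A; λ) = [(Ψ∘η)_A | {(r∘Ψ) D + λ W} T]`. -/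
def matrixM (X : Matrix (Fin n) (Fin p) ℝ) (grp : Fin p → Fin J) (w : Fin J → ℝ)
    (α lam : ℝ) (A : Finset (Fin J)) (r : A → ℝ) (s : Fin p → ℝ)
    (T : Matrix (Fin p) (Fin (n - A.card)) ℝ) : Matrix (Fin p) (A ⊕ Fin (n - A.card)) ℝ :=
  Matrix.fromCols ((gramEta X grp α s).submatrix id Subtype.val)
    ((scaledGram X grp A r * derivMatrix grp α A s + lam • weightMatrix grp w) * T)

/-- An enumeration of the `n` columns of `M`. -/
def columnEquiv (A : Finset (Fin J)) (hA : A.card ≤ n) : Fin n ≃ A ⊕ Fin (n - A.card) :=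
  Fintype.equivOfCardEq (by
    rw [Fintype.card_sum, Fintype.card_coe, Fintype.card_fin, Fintype.card_fin]; omega)

/-- `|J_A(r_A, s; λ)| = |det [√n (Xᵀ)⁺ M(r_A, s, A; λ)]|`, which does not depend on the order of the
columns of `M`. -/
def absJacobian (X : Matrix (Fin n) (Fin p) ℝ) (grp : Fin p → Fin J) (w : Fin J → ℝ)
    (α lam : ℝ) (A : Finset (Fin J)) (hA : A.card ≤ n) (r : A → ℝ) (s : Fin p → ℝ)
    (T : Matrix (Fin p) (Fin (n - A.card)) ℝ) : ℝ :=
  |((√(n : ℝ) • (pinv Xᵀ * matrixM X grp w α lam A r s T)).submatrix id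
    (columnEquiv A hA)).det|

/-- The density `f_A(r_A, s) = g_n(H̃_A(r_A, s)) |J_A(r_A, s)|` in the coordinates
`θ = (r_A, s_F)`, where `T` is the tangent matrix of the coordinates `s_F`. -/
def density (X : Matrix (Fin n) (Fin p) ℝ) (grp : Fin p → Fin J) (w : Fin J → ℝ)
    (α lam : ℝ) (β₀ : Fin p → ℝ) (g : (Fin n → ℝ) → ℝ≥0∞) (A : Finset (Fin J))
    (hA : A.card ≤ n) (r : A → ℝ) (s : Fin p → ℝ)
    (T : Matrix (Fin p) (Fin (n - A.card)) ℝ) : ℝ≥0∞ :=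
  g (mapHTilde X grp w α lam β₀ A r s) *
    ENNReal.ofReal (absJacobian X grp w α lam A hA r s T)

end Model

end BlockLasso

end

/-! The loss is convex, so for a pair `(β, S)` minimality follows from the KKT equation together
with the duality relation β_(j) = ‖β_(j)‖_α η(S_(j)), ‖S_(j)‖_{α*} ≤ 1, with equality on active
groups (`isAugmentedSolution_iff`). An augmented solution is therefore encoded by (r_A, s, A) with
β_(j) = r_j η(s_(j)), and KKT, solved for the noise, reads ε/√n = H̃_A(r_A, s). Conversely every
point of Ω_A solves the problem for the response X β₀ + √n H̃_A(r_A, s). So the event for the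
estimator is the event that ε/√n lies in an image under H̃_A (`estimator_mem_iff`), and the law
comes from a change of variables.

Two facts make this work. The first is uniqueness, which also gives injectivity of H̃_A.
Monotonicity of subgradients determines the fit X β and hence S; then β is determined because the
vectors w_j⁻¹ X_(j) η(s_(j)) with ‖s_(j)‖_{α*} = 1 are linearly independent. Indeed, if s = W⁻¹ Xᵀ
z, each has inner product ⟨s_(j), η(s_(j))⟩ = 1 with z, so they lie on a hyperplane missing the
origin, where affine independence is linear independence (`linearIndependent_blockVec`). These
vectors are also, up to the factor α*, the gradients in z of the constraints defining M_A, so the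
same independence yields the local coordinates s_F by the inverse function theorem
(`exists_local_coordinates`).

The second is the area formula under weak regularity. The function η may fail to be differentiable
at 0, so Δ is cut into finitely many pieces on which the set of vanishing entries of Φ is fixed; on
each piece η ∘ Φ is differentiable, with the stated convention for η'(0). Moreover Δ is only
measurable, so a derivative within Δ need not be tangent to M_A at every point, but it is at almost
every point (`ae_mem_tangentSet`). There it equals T times ∂s_F/∂u, and the Jacobian splits as J_A ·
det(∂s_F/∂u) (`abs_det_lawDeriv`). -/

namespace BlockLasso

/-! ### The scalar functions η and η⁻¹. -/

section Scalar

variable {α : ℝ}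

theorem rho_eq (hα : 1 < α) : rho α = Real.conjExponent α - 1 := by
  have : α - 1 ≠ 0 := by linarith
  have : α ≠ 0 := by linarith
  simp only [rho, Real.conjExponent]
  field_simp
  ring

theorem rho_pos (hα : 1 < α) : 0 < rho α := by
  rw [rho_eq hα]
  linarith [(Real.HolderConjugate.conjExponent hα).symm.lt]

theorem rho_mul (hα : 1 < α) : rho α * α = Real.conjExponent α := by
  rw [rho, div_mul_cancel₀ _ (by linarith)]

theorem conjExponent_pos (hα : 1 < α) : 0 < Real.conjExponent α :=
  (Real.HolderConjugate.conjExponent hα).symm.pos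

theorem one_lt_conjExponent (hα : 1 < α) : 1 < Real.conjExponent α :=
  (Real.HolderConjugate.conjExponent hα).symm.lt

theorem eta_zero : eta α 0 = 0 := by simp [eta]

theorem sign_mul_abs_rpow_inv (x : ℝ) {a b : ℝ} (hab : a * b = 1) :
    Real.sign (Real.sign x * |x| ^ a) * |Real.sign x * |x| ^ a| ^ b = x := by
  rcases lt_trichotomy x 0 with hx | rfl | hx
  · have h : 0 < |x| ^ a := Real.rpow_pos_of_pos (abs_pos.2 hx.ne) _
    rw [Real.sign_of_neg hx, neg_one_mul, Real.sign_of_neg (by linarith), abs_neg, abs_of_pos h,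
      ← Real.rpow_mul (abs_nonneg _), hab, Real.rpow_one, abs_of_neg hx]
    ring
  · simp
  · have h : 0 < |x| ^ a := Real.rpow_pos_of_pos (abs_pos.2 hx.ne') _
    rw [Real.sign_of_pos hx, one_mul, Real.sign_of_pos h, abs_of_pos h,
      ← Real.rpow_mul (abs_nonneg _), hab, Real.rpow_one, abs_of_pos hx]
    ring

theorem etaInv_eta (hα : 1 < α) (x : ℝ) : etaInv α (eta α x) = x :=
  sign_mul_abs_rpow_inv x (by field_simp [(rho_pos hα).ne'])

theorem eta_etaInv (hα : 1 < α) (x : ℝ) : eta α (etaInv α x) = x :=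
  sign_mul_abs_rpow_inv x (by field_simp [(rho_pos hα).ne'])

theorem abs_eta (hα : 1 < α) (x : ℝ) : |eta α x| = |x| ^ rho α := by
  rcases lt_trichotomy x 0 with hx | rfl | hx
  · rw [eta, Real.sign_of_neg hx, abs_mul, abs_neg, abs_one, one_mul,
      abs_of_nonneg (Real.rpow_nonneg (abs_nonneg _) _)]
  · simp [eta, Real.zero_rpow (rho_pos hα).ne']
  · rw [eta, Real.sign_of_pos hx, abs_mul, abs_one, one_mul,
      abs_of_nonneg (Real.rpow_nonneg (abs_nonneg _) _)]

theorem abs_eta_rpow (hα : 1 < α) (x : ℝ) : |eta α x| ^ α = |x| ^ Real.conjExponent α := by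
  rw [abs_eta hα, ← Real.rpow_mul (abs_nonneg _), rho_mul hα]

/-- Since ρ = α* − 1, this is the form in which η appears, up to the factor α*, as the derivative of
|x| ^ α*. -/
theorem eta_eq (hα : 1 < α) (x : ℝ) : eta α x = |x| ^ (Real.conjExponent α - 2) * x := by
  rcases lt_trichotomy x 0 with hx | rfl | hx
  · have h : 0 < |x| := abs_pos.2 hx.ne
    rw [eta, Real.sign_of_neg hx, rho_eq hα,
      show Real.conjExponent α - 1 = (Real.conjExponent α - 2) + 1 by ring, Real.rpow_add_one h.ne']
    rw [abs_of_neg hx]; ring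
  · simp [eta]
  · have h : 0 < |x| := abs_pos.2 hx.ne'
    rw [eta, Real.sign_of_pos hx, rho_eq hα,
      show Real.conjExponent α - 1 = (Real.conjExponent α - 2) + 1 by ring, Real.rpow_add_one h.ne']
    rw [abs_of_pos hx]; ring

theorem mul_eta (hα : 1 < α) (x : ℝ) : x * eta α x = |x| ^ Real.conjExponent α := by
  rcases eq_or_ne x 0 with rfl | hx
  · simp [Real.zero_rpow (conjExponent_pos hα).ne']
  · have h : 0 < |x| := abs_pos.2 hx
    rw [eta_eq hα]
    calc x * (|x| ^ (Real.conjExponent α - 2) * x)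
        = |x| ^ (Real.conjExponent α - 2) * |x| ^ (2 : ℝ) := by
          rw [Real.rpow_two, sq_abs]; ring
      _ = _ := by rw [← Real.rpow_add h]; congr 1; ring

theorem hasDerivAt_abs_rpow_conjExponent (hα : 1 < α) (x : ℝ) :
    HasDerivAt (fun x : ℝ => |x| ^ Real.conjExponent α) (Real.conjExponent α * eta α x) x := by
  have := hasDerivAt_abs_rpow x (one_lt_conjExponent hα)
  rwa [mul_assoc, ← eta_eq hα] at this

theorem continuous_eta (hα : 1 < α) : Continuous (eta α) := by
  have hq := one_lt_conjExponent hα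
  have hc : Continuous fun x : ℝ => |x| ^ rho α :=
    continuous_abs.rpow_const fun _ => Or.inr (rho_pos hα).le
  rw [continuous_iff_continuousAt]
  intro x
  -- The exponent α* − 2 in `eta_eq` may be negative, so 0 needs its own argument, from |η(x)| = |x|
  -- ^ ρ.
  rcases eq_or_ne x 0 with rfl | hx
  · have h0 : Filter.Tendsto (fun x : ℝ => |x| ^ rho α) (nhds 0) (nhds 0) := by
      simpa [Real.zero_rpow (rho_pos hα).ne'] using hc.tendsto 0
    rw [ContinuousAt, eta_zero]
    refine squeeze_zero_norm (fun y => ?_) h0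
    rw [Real.norm_eq_abs, abs_eta hα]
  · rw [funext (eta_eq hα)]
    exact (continuousAt_id.abs.rpow_const (Or.inl (by simpa using hx))).mul continuousAt_id

/-- The derivative is continuous even where η itself is not differentiable. Strictness is what the
inverse function theorem asks of the constraints of M_A. -/
theorem hasStrictDerivAt_abs_rpow_conjExponent (hα : 1 < α) (x : ℝ) :
    HasStrictDerivAt (fun x : ℝ => |x| ^ Real.conjExponent α)
      (Real.conjExponent α * eta α x) x :=
  hasStrictDerivAt_of_hasDerivAt_of_continuousAt
    (Filter.Eventually.of_forall fun y => hasDerivAt_abs_rpow_conjExponent hα y)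
    (continuous_const.mul (continuous_eta hα)).continuousAt

theorem hasDerivAt_eta {x : ℝ} (hx : x ≠ 0) :
    HasDerivAt (eta α) (etaDeriv α x) x := by
  have h : 0 < |x| := abs_pos.2 hx
  have key := ((hasDerivAt_abs hx).rpow_const (p := rho α) (Or.inl h.ne')).const_mul
    (Real.sign x)
  have hsign : Real.sign x * (SignType.sign x : ℝ) = 1 := by
    rcases hx.lt_or_gt with hx | hx
    · simp [Real.sign_of_neg hx, hx]
    · simp [Real.sign_of_pos hx, hx]
  have hev : eta α =ᶠ[nhds x] fun y => Real.sign x * |y| ^ rho α := by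
    rcases hx.lt_or_gt with hx | hx
    · filter_upwards [eventually_lt_nhds hx] with y hy
      rw [eta, Real.sign_of_neg hx, Real.sign_of_neg hy]
    · filter_upwards [eventually_gt_nhds hx] with y hy
      rw [eta, Real.sign_of_pos hx, Real.sign_of_pos hy]
  refine (key.congr_of_eventuallyEq hev).congr_deriv ?_
  rw [etaDeriv, ← mul_assoc, ← mul_assoc, hsign, one_mul]

theorem eta_of_rho_eq_one (h : rho α = 1) (x : ℝ) : eta α x = x := by
  rw [eta, h, Real.rpow_one]
  rcases lt_trichotomy x 0 with hx | rfl | hx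
  · rw [Real.sign_of_neg hx, abs_of_neg hx]; ring
  · simp
  · rw [Real.sign_of_pos hx, abs_of_pos hx]; ring

/-- True at x = 0 as well because 0 ^ 0 = 1 for real powers, in agreement with η being the identity.
-/
theorem etaDeriv_of_rho_eq_one (h : rho α = 1) (x : ℝ) : etaDeriv α x = 1 := by
  simp [etaDeriv, h]

/-- For ρ > 1 this is the actual derivative; for ρ < 1 it is the convention that 0 to a nonzero real
power is 0. -/
theorem etaDeriv_zero (h : rho α ≠ 1) : etaDeriv α 0 = 0 := by
  rw [etaDeriv, abs_zero, Real.zero_rpow (sub_ne_zero.2 h), mul_zero]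

/-- The equality case of Young's inequality. -/
theorem eq_etaInv_of_mul_eq (hα : 1 < α) {s x : ℝ}
    (h : s * x = |x| ^ α / α + |s| ^ Real.conjExponent α / Real.conjExponent α) :
    s = etaInv α x := by
  set q := Real.conjExponent α with hq
  have hq0 : q ≠ 0 := (conjExponent_pos hα).ne'
  -- The gap in Young's inequality is nonnegative in t and vanishes at t = s, so its derivative η(s)
  -- − x vanishes.
  let φ : ℝ → ℝ := fun t => |x| ^ α / α + |t| ^ q / q - t * x
  have hmin : IsLocalMin φ s := by
    refine Filter.Eventually.of_forall fun t => ?_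
    have h1 := Real.young_inequality x t (Real.HolderConjugate.conjExponent hα)
    have h2 : φ s = 0 := by simp only [φ]; linarith
    rw [h2]
    simp only [φ]
    linarith [mul_comm t x]
  have hd : HasDerivAt φ (q * eta α s / q - 1 * x) s :=
    (((hasDerivAt_abs_rpow_conjExponent hα s).div_const q).const_add _).sub
      ((hasDerivAt_id s).mul_const x)
  have h0 := hmin.hasDerivAt_eq_zero hd
  have : eta α s = x := by
    rw [mul_div_cancel_left₀ _ hq0] at h0
    linarith
  rw [← this, etaInv_eta hα]

end Scalar

/-! ### Block norms and dual pairs (Hölder's inequality and its equality case). -/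

section Block

variable {p J : ℕ} {grp : Fin p → Fin J} {α : ℝ}

theorem sum_abs_rpow_nonneg (q : ℝ) (v : Fin p → ℝ) (j : Fin J) :
    0 ≤ ∑ k with grp k = j, |v k| ^ q :=
  Finset.sum_nonneg fun _ _ => Real.rpow_nonneg (abs_nonneg _) _

theorem blockNorm_nonneg (q : ℝ) (v : Fin p → ℝ) (j : Fin J) : 0 ≤ blockNorm grp q v j :=
  Real.rpow_nonneg (sum_abs_rpow_nonneg q v j) _

theorem blockNorm_rpow {q : ℝ} (hq : 0 < q) (v : Fin p → ℝ) (j : Fin J) :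
    blockNorm grp q v j ^ q = ∑ k with grp k = j, |v k| ^ q := by
  rw [blockNorm, ← Real.rpow_mul (sum_abs_rpow_nonneg q v j), one_div_mul_cancel hq.ne',
    Real.rpow_one]

theorem blockNorm_le_one_iff {q : ℝ} (hq : 0 < q) (v : Fin p → ℝ) (j : Fin J) :
    blockNorm grp q v j ≤ 1 ↔ ∑ k with grp k = j, |v k| ^ q ≤ 1 := by
  rw [← blockNorm_rpow hq]
  conv_rhs => rw [← Real.one_rpow q]
  exact (Real.rpow_le_rpow_iff (blockNorm_nonneg _ _ _) zero_le_one hq).symm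

theorem blockNorm_eq_one_iff {q : ℝ} (hq : 0 < q) (v : Fin p → ℝ) (j : Fin J) :
    blockNorm grp q v j = 1 ↔ ∑ k with grp k = j, |v k| ^ q = 1 := by
  rw [← blockNorm_rpow hq]
  conv_rhs => rw [← Real.one_rpow q]
  exact (Real.rpow_left_inj (blockNorm_nonneg _ _ _) zero_le_one hq.ne').symm

theorem mem_activeGroups {v : Fin p → ℝ} {j : Fin J} :
    j ∈ activeGroups grp v ↔ ∃ k, grp k = j ∧ v k ≠ 0 := by
  simp [activeGroups]

theorem eq_zero_of_not_mem_activeGroups {v : Fin p → ℝ} {j : Fin J}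
    (h : j ∉ activeGroups grp v) {k : Fin p} (hk : grp k = j) : v k = 0 := by
  by_contra hv
  exact h (mem_activeGroups.2 ⟨k, hk, hv⟩)

theorem blockNorm_eq_zero_iff {q : ℝ} (hq : 0 < q) {v : Fin p → ℝ} {j : Fin J} :
    blockNorm grp q v j = 0 ↔ j ∉ activeGroups grp v := by
  rw [← Real.rpow_eq_zero (blockNorm_nonneg q v j) hq.ne', blockNorm_rpow hq,
    Finset.sum_eq_zero_iff_of_nonneg fun _ _ => Real.rpow_nonneg (abs_nonneg _) _,
    mem_activeGroups]
  simp [Real.rpow_eq_zero (abs_nonneg _) hq.ne']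

theorem blockNorm_pos_iff {q : ℝ} (hq : 0 < q) {v : Fin p → ℝ} {j : Fin J} :
    0 < blockNorm grp q v j ↔ j ∈ activeGroups grp v := by
  rw [(blockNorm_nonneg q v j).lt_iff_ne', Ne, blockNorm_eq_zero_iff hq, not_not]

theorem continuous_sum_abs_rpow {q : ℝ} (hq : 0 ≤ q) (j : Fin J) :
    Continuous fun v : Fin p → ℝ => ∑ k with grp k = j, |v k| ^ q :=
  continuous_finsetSum _ fun k _ =>
    (continuous_apply k).abs.rpow_const fun _ => Or.inr hq

theorem continuous_blockNorm {q : ℝ} (hq : 0 < q) (j : Fin J) :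
    Continuous fun v : Fin p → ℝ => blockNorm grp q v j :=
  (continuous_sum_abs_rpow hq.le j).rpow_const fun _ => Or.inr (one_div_pos.2 hq).le

theorem block_inner_le (hα : 1 < α) (s b : Fin p → ℝ) (j : Fin J) :
    ∑ k with grp k = j, s k * b k ≤
      blockNorm grp (Real.conjExponent α) s j * blockNorm grp α b j :=
  Real.inner_le_Lp_mul_Lq _ _ _ (Real.HolderConjugate.conjExponent hα).symm

theorem blockNorm_congr {q : ℝ} {v v' : Fin p → ℝ} {j : Fin J}
    (h : ∀ k, grp k = j → v k = v' k) : blockNorm grp q v j = blockNorm grp q v' j := by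
  unfold blockNorm
  congr 1
  exact Finset.sum_congr rfl fun k hk => by rw [h k (Finset.mem_filter.1 hk).2]

theorem blockNorm_smul {q : ℝ} (hq : 0 < q) {c : ℝ} (hc : 0 ≤ c) (v : Fin p → ℝ) (j : Fin J) :
    blockNorm grp q (c • v) j = c * blockNorm grp q v j := by
  have : ∑ k with grp k = j, |(c • v) k| ^ q = c ^ q * ∑ k with grp k = j, |v k| ^ q := by
    rw [Finset.mul_sum]
    refine Finset.sum_congr rfl fun k _ => ?_
    rw [Pi.smul_apply, smul_eq_mul, abs_mul, abs_of_nonneg hc,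
      Real.mul_rpow hc (abs_nonneg _)]
  rw [blockNorm, this, Real.mul_rpow (Real.rpow_nonneg hc _) (sum_abs_rpow_nonneg q v j),
    ← Real.rpow_mul hc, mul_one_div_cancel hq.ne', Real.rpow_one, blockNorm]

theorem blockNorm_add_le {q : ℝ} (hq : 1 ≤ q) (u v : Fin p → ℝ) (j : Fin J) :
    blockNorm grp q (u + v) j ≤ blockNorm grp q u j + blockNorm grp q v j :=
  Real.Lp_add_le _ u v hq

theorem blockNorm_eta (hα : 1 < α) {s : Fin p → ℝ} {j : Fin J}
    (h : blockNorm grp (Real.conjExponent α) s j = 1) :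
    blockNorm grp α (fun k => eta α (s k)) j = 1 := by
  rw [blockNorm_eq_one_iff (by linarith)]
  simp_rw [abs_eta_rpow hα]
  rwa [blockNorm_eq_one_iff (conjExponent_pos hα)] at h

theorem sum_mul_eta (hα : 1 < α) {s : Fin p → ℝ} {j : Fin J}
    (h : blockNorm grp (Real.conjExponent α) s j = 1) :
    ∑ k with grp k = j, s k * eta α (s k) = 1 := by
  simp_rw [mul_eta hα]
  rwa [blockNorm_eq_one_iff (conjExponent_pos hα)] at h

/-- Each block of `S` is a subgradient of the `ℓ_α` norm at the corresponding block of `β`. -/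
structure IsDualPair (grp : Fin p → Fin J) (α : ℝ) (β S : Fin p → ℝ) : Prop where
  norm_le : ∀ j, blockNorm grp (Real.conjExponent α) S j ≤ 1
  norm_eq : ∀ j ∈ activeGroups grp β, blockNorm grp (Real.conjExponent α) S j = 1
  eq_mul_eta : ∀ k, β k = blockNorm grp α β (grp k) * eta α (S k)

/-- Applying η to S_(j) = η⁻¹(β_(j) / ‖β_(j)‖_α) removes the quotient and gives an identity that
also holds on inactive groups, where both sides are 0. The dual norm is 1 on active groups because
|S_k| ^ α* = |η(S_k)| ^ α. -/
theorem isDualPair_iff (hα : 1 < α) {β S : Fin p → ℝ} : IsDualPair grp α β S ↔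
    (∀ j ∈ activeGroups grp β, ∀ k, grp k = j →
      S k = etaInv α (β k / blockNorm grp α β j)) ∧
    ∀ j ∉ activeGroups grp β, blockNorm grp (Real.conjExponent α) S j ≤ 1 := by
  have hα0 : 0 < α := by linarith
  constructor
  · refine fun h => ⟨?_, fun j _ => h.norm_le j⟩
    rintro j hj k rfl
    have := (blockNorm_pos_iff hα0).2 hj
    rw [h.eq_mul_eta k, mul_div_cancel_left₀ _ this.ne', etaInv_eta hα]
  · rintro ⟨h1, h2⟩
    have key : ∀ j ∈ activeGroups grp β, ∀ k, grp k = j →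
        eta α (S k) = β k / blockNorm grp α β j := fun j hj k hk => by
      rw [h1 j hj k hk, eta_etaInv hα]
    have hn : ∀ j ∈ activeGroups grp β, blockNorm grp (Real.conjExponent α) S j = 1 := by
      intro j hj
      have hpos := (blockNorm_pos_iff hα0).2 hj
      rw [blockNorm_eq_one_iff (conjExponent_pos hα)]
      calc ∑ k with grp k = j, |S k| ^ Real.conjExponent α
          = ∑ k with grp k = j, |β k| ^ α / blockNorm grp α β j ^ α := by
            refine Finset.sum_congr rfl fun k hk => ?_
            rw [← abs_eta_rpow hα, key j hj k (Finset.mem_filter.1 hk).2, abs_div,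
              abs_of_pos hpos, Real.div_rpow (abs_nonneg _) hpos.le]
        _ = 1 := by
            rw [← Finset.sum_div, ← blockNorm_rpow hα0, div_self]
            exact (Real.rpow_pos_of_pos hpos _).ne'
    refine ⟨fun j => ?_, hn, fun k => ?_⟩
    · by_cases hj : j ∈ activeGroups grp β
      · exact (hn j hj).le
      · exact h2 j hj
    · by_cases hj : grp k ∈ activeGroups grp β
      · rw [key _ hj k rfl, mul_div_cancel₀ _ ((blockNorm_pos_iff hα0).2 hj).ne']
      · rw [(blockNorm_eq_zero_iff hα0).2 hj, zero_mul, eq_zero_of_not_mem_activeGroups hj rfl]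

theorem IsDualPair.inner_eq (hα : 1 < α) {β S : Fin p → ℝ} (h : IsDualPair grp α β S)
    (j : Fin J) : ∑ k with grp k = j, S k * β k = blockNorm grp α β j := by
  have : ∑ k with grp k = j, S k * β k =
      blockNorm grp α β j * ∑ k with grp k = j, S k * eta α (S k) := by
    rw [Finset.mul_sum]
    refine Finset.sum_congr rfl fun k hk => ?_
    conv_lhs => rw [h.eq_mul_eta k, (Finset.mem_filter.1 hk).2]
    ring
  rw [this]
  by_cases hj : j ∈ activeGroups grp β
  · rw [sum_mul_eta hα (h.norm_eq j hj), mul_one]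
  · rw [(blockNorm_eq_zero_iff (by linarith)).2 hj, zero_mul]

theorem IsDualPair.inner_le (hα : 1 < α) {β S : Fin p → ℝ} (h : IsDualPair grp α β S)
    (b : Fin p → ℝ) (j : Fin J) : ∑ k with grp k = j, S k * b k ≤ blockNorm grp α b j :=
  (block_inner_le hα S b j).trans
    (mul_le_of_le_one_left (blockNorm_nonneg _ _ _) (h.norm_le j))

/-- Equality in Hölder's inequality. -/
theorem isDualPair_of_inner (hα : 1 < α) {β S : Fin p → ℝ}
    (heq : ∀ j, ∑ k with grp k = j, S k * β k = blockNorm grp α β j)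
    (hle : ∀ b j, ∑ k with grp k = j, S k * b k ≤ blockNorm grp α b j) :
    IsDualPair grp α β S := by
  have hα0 : 0 < α := by linarith
  have hq := conjExponent_pos hα
  have hnorm : ∀ j, blockNorm grp (Real.conjExponent α) S j ≤ 1 := by
    intro j
    rw [blockNorm_le_one_iff hq]
    -- Testing on the extremal vector η(S) gives N ≤ N ^ (1/α), which rules out N > 1 since 1/α < 1.
    have h1 := hle (fun k => eta α (S k)) j
    simp_rw [mul_eta hα] at h1
    set N := ∑ k with grp k = j, |S k| ^ Real.conjExponent α with hN
    have h2 : blockNorm grp α (fun k => eta α (S k)) j = N ^ (1 / α) := by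
      simp_rw [blockNorm, abs_eta_rpow hα, hN]
    rw [h2] at h1
    by_contra hlt
    push Not at hlt
    have : N ^ (1 / α) < N ^ (1 : ℝ) :=
      Real.rpow_lt_rpow_of_exponent_lt hlt (by rw [div_lt_one hα0]; exact hα)
    rw [Real.rpow_one] at this
    linarith
  rw [isDualPair_iff hα]
  refine ⟨fun j hj => ?_, fun j _ => hnorm j⟩
  have hpos := (blockNorm_pos_iff hα0).2 hj
  have hc := Real.HolderConjugate.conjExponent hα
  set c := blockNorm grp α β j with hcdef
  have hx : ∑ k with grp k = j, |β k / c| ^ α = 1 := by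
    simp_rw [abs_div, abs_of_pos hpos, Real.div_rpow (abs_nonneg _) hpos.le]
    rw [← Finset.sum_div, ← blockNorm_rpow hα0, div_self]
    exact (Real.rpow_pos_of_pos hpos _).ne'
  have hs : ∑ k with grp k = j, |S k| ^ Real.conjExponent α ≤ 1 :=
    (blockNorm_le_one_iff hq _ _).1 (hnorm j)
  have hsx : ∑ k with grp k = j, S k * (β k / c) = 1 := by
    simp_rw [mul_div_assoc']
    rw [← Finset.sum_div, heq j, div_self hpos.ne']
  -- Young's gaps are termwise nonnegative, while their sum is at most 1/α + 1/α* − 1 = 0; hence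
  -- every term is an equality case.
  have hy : ∀ k, 0 ≤ |β k / c| ^ α / α + |S k| ^ Real.conjExponent α / Real.conjExponent α
      - S k * (β k / c) := fun k => by
    have := Real.young_inequality (β k / c) (S k) hc
    linarith [mul_comm (S k) (β k / c)]
  have hsum : ∑ k with grp k = j, (|β k / c| ^ α / α +
      |S k| ^ Real.conjExponent α / Real.conjExponent α - S k * (β k / c)) = 0 := by
    refine le_antisymm ?_ (Finset.sum_nonneg fun k _ => hy k)
    rw [Finset.sum_sub_distrib, Finset.sum_add_distrib, ← Finset.sum_div, ← Finset.sum_div, hx,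
      hsx]
    have h1 := hc.inv_add_inv_eq_one
    have h2 := div_le_div_of_nonneg_right hs hq.le
    rw [← one_div, ← one_div] at h1
    linarith
  intro k hk
  have := (Finset.sum_eq_zero_iff_of_nonneg fun k _ => hy k).1 hsum k (by simp [hk])
  exact eq_etaInv_of_mul_eq hα (by linarith)

end Block

/-! ### Existence, uniqueness and measurability of the augmented solution. -/

section Solution

variable {n p J : ℕ} {X : Matrix (Fin n) (Fin p) ℝ} {grp : Fin p → Fin J} {w : Fin J → ℝ}
  {α lam : ℝ}

theorem sum_groups (grp : Fin p → Fin J) (f : Fin p → ℝ) :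
    ∑ j, ∑ k with grp k = j, f k = ∑ k, f k :=
  Finset.sum_fiberwise _ _ _

theorem weightMatrix_inv (hw : ∀ j, 0 < w j) :
    (weightMatrix grp w)⁻¹ = Matrix.diagonal fun k => (w (grp k))⁻¹ := by
  refine Matrix.inv_eq_right_inv ?_
  rw [weightMatrix, Matrix.diagonal_mul_diagonal, ← Matrix.diagonal_one]
  congr 1
  ext k
  exact mul_inv_cancel₀ (hw _).ne'

/-- Any n columns of X form a basis of ℝⁿ, and z is orthogonal to all of them. -/
theorem transpose_mulVec_injective (hnp : n ≤ p) (hX : ColumnsIndependent X) {z : Fin n → ℝ}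
    (hz : Xᵀ *ᵥ z = 0) : z = 0 := by
  obtain ⟨I, -, hI⟩ := Finset.exists_subset_card_eq
    (s := (Finset.univ : Finset (Fin p))) (n := n) (by simpa using hnp)
  have hli := hX I (by rw [hI, min_eq_left hnp])
  have hspan := hli.span_eq_top_of_card_eq_finrank' (by simp [hI])
  have hmem : z ∈ Submodule.span ℝ (Set.range fun k : I => X.col k) := by
    rw [hspan]; trivial
  have hker : Submodule.span ℝ (Set.range fun k : I => X.col k) ≤
      LinearMap.ker (dotProductBilin ℝ ℝ z) := by
    rw [Submodule.span_le]
    rintro _ ⟨k, rfl⟩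
    have := congrFun hz k
    simp only [Matrix.mulVec, Pi.zero_apply] at this
    rw [dotProduct_comm] at this
    exact this
  have := hker hmem
  simpa using this

/-- The parameterization `z ↦ W⁻¹ Xᵀ z` of `𝒱`. -/
noncomputable def subgradMap (X : Matrix (Fin n) (Fin p) ℝ) (grp : Fin p → Fin J) (w : Fin J → ℝ) :
    (Fin n → ℝ) →ₗ[ℝ] (Fin p → ℝ) :=
  (X * Matrix.diagonal fun k => (w (grp k))⁻¹)ᵀ.mulVecLin

theorem subgradMap_apply (z : Fin n → ℝ) (k : Fin p) :
    subgradMap X grp w z k = (w (grp k))⁻¹ * (Xᵀ *ᵥ z) k := by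
  rw [subgradMap, Matrix.mulVecLin_apply, Matrix.transpose_mul, Matrix.diagonal_transpose,
    ← Matrix.mulVec_mulVec, Matrix.mulVec_diagonal]

theorem range_subgradMap (hw : ∀ j, 0 < w j) :
    LinearMap.range (subgradMap X grp w) = subgradSpace X grp w := by
  rw [subgradMap, Matrix.range_mulVecLin, subgradSpace, weightMatrix_inv hw, rowSpace]
  rfl

theorem mem_subgradSpace (hw : ∀ j, 0 < w j) {s : Fin p → ℝ} :
    s ∈ subgradSpace X grp w ↔ ∃ z, subgradMap X grp w z = s := by
  rw [← range_subgradMap hw, LinearMap.mem_range]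

theorem subgradMap_injective (hnp : n ≤ p) (hX : ColumnsIndependent X) (hw : ∀ j, 0 < w j) :
    Function.Injective (subgradMap X grp w) := by
  rw [← LinearMap.ker_eq_bot, LinearMap.ker_eq_bot']
  intro z hz
  refine transpose_mulVec_injective hnp hX ?_
  ext k
  have := congrFun hz k
  rw [subgradMap_apply] at this
  simpa [(hw _).ne'] using this

/-- The vectors `w_j⁻¹ X_(j) η(s_(j))`. -/
noncomputable def blockVec (X : Matrix (Fin n) (Fin p) ℝ) (grp : Fin p → Fin J) (w : Fin J → ℝ) (α : ℝ)
    (s : Fin p → ℝ) (j : Fin J) (i : Fin n) : ℝ :=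
  ∑ k with grp k = j, (w j)⁻¹ * X i k * eta α (s k)

/-- In the coordinate z of 𝒱, the tangency condition ⟨η(s_(j)), ds_(j)⟩ = 0 is orthogonality to this
vector. Taking s itself as the image of z gives the inner product ‖s_(j)‖_{α*} ^ α*. -/
theorem blockVec_dotProduct (s : Fin p → ℝ) (j : Fin J) (z : Fin n → ℝ) :
    blockVec X grp w α s j ⬝ᵥ z =
      ∑ k with grp k = j, eta α (s k) * subgradMap X grp w z k := by
  simp_rw [dotProduct, blockVec, Finset.sum_mul]
  rw [Finset.sum_comm]
  refine Finset.sum_congr rfl fun k hk => ?_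
  rw [subgradMap_apply, (Finset.mem_filter.1 hk).2, Matrix.mulVec, dotProduct, Finset.mul_sum,
    Finset.mul_sum]
  refine Finset.sum_congr rfl fun i _ => ?_
  rw [Matrix.transpose_apply]
  ring

/-- With s = W⁻¹ Xᵀ z, all these vectors lie on the hyperplane ⟨·, z⟩ = 1. A linear relation, paired
with z, has coefficients of sum 0, so it is an affine relation and general position makes it
trivial. -/
theorem linearIndependent_blockVec (hα : 1 < α) (hw : ∀ j, 0 < w j)
    (hpos : BlockwiseGeneralPosition (X * (weightMatrix grp w)⁻¹) grp α) {s : Fin p → ℝ}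
    (hs : s ∈ subgradSpace X grp w) :
    LinearIndependent ℝ
      fun j : {j : Fin J // blockNorm grp (Real.conjExponent α) s j = 1} =>
        blockVec X grp w α s j := by
  obtain ⟨z, rfl⟩ := (mem_subgradSpace hw).1 hs
  set s := subgradMap X grp w z with hsdef
  have hgp : InGeneralPosition
      fun j : {j : Fin J // blockNorm grp (Real.conjExponent α) s j = 1} =>
        blockVec X grp w α s j := by
    have := hpos s hs
    rw [weightMatrix_inv hw] at this
    convert this using 3 with j i
    rw [blockVec]
    refine Finset.sum_congr rfl fun k hk => ?_
    rw [Matrix.mul_diagonal, (Finset.mem_filter.1 hk).2, mul_comm (w _)⁻¹]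
  have hdot : ∀ j : {j : Fin J // blockNorm grp (Real.conjExponent α) s j = 1},
      blockVec X grp w α s j ⬝ᵥ z = 1 := fun j => by
    rw [blockVec_dotProduct]
    exact (Finset.sum_congr rfl fun k _ => mul_comm _ _).trans (sum_mul_eta hα j.2)
  have hfin : ∀ I : Finset {j : Fin J // blockNorm grp (Real.conjExponent α) s j = 1},
      I.card ≤ n + 1 → ∀ c : {j : Fin J // blockNorm grp (Real.conjExponent α) s j = 1} → ℝ,
      ∑ j ∈ I, c j • blockVec X grp w α s j = 0 → ∀ j ∈ I, c j = 0 := by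
    intro I hI c hc j hj
    have h1 : ∑ j ∈ I, c j = 0 := by
      have := congrArg (fun v => v ⬝ᵥ z) hc
      simpa [sum_dotProduct, smul_dotProduct, hdot] using this
    have h2 := (affineIndependent_iff.1 (hgp I hI)) Finset.univ (fun j => c j)
      ((Finset.sum_coe_sort I c).trans h1)
      ((Finset.sum_coe_sort I fun j => c j • blockVec X grp w α s j).trans hc)
    exact h2 ⟨j, hj⟩ (Finset.mem_univ _)
  -- General position only concerns n + 1 or fewer vectors. If there were more than n, then n + 1 of
  -- them would be linearly independent in ℝⁿ.
  have hcard : Fintype.card {j : Fin J // blockNorm grp (Real.conjExponent α) s j = 1} ≤ n := by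
    by_contra hlt
    push Not at hlt
    obtain ⟨I, -, hI⟩ := Finset.exists_subset_card_eq (n := n + 1)
      (s := (Finset.univ : Finset {j : Fin J // blockNorm grp (Real.conjExponent α) s j = 1}))
      (by rw [Finset.card_univ]; exact hlt)
    have hli : LinearIndependent ℝ fun j : I => blockVec X grp w α s j.1 := by
      rw [Fintype.linearIndependent_iff]
      intro c hc j
      have := hfin I hI.le (fun j => if h : j ∈ I then c ⟨j, h⟩ else 0)
        (by
          rw [← Finset.sum_coe_sort]
          simpa using hc) j j.2
      simpa using this
    have := hli.fintype_card_le_finrank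
    simp [hI] at this
  rw [Fintype.linearIndependent_iff]
  exact fun c hc j => hfin Finset.univ (by rw [Finset.card_univ]; omega) c hc j
    (Finset.mem_univ _)

theorem linearIndependent_blockVec_of_mem (hα : 1 < α) (hw : ∀ j, 0 < w j)
    (hpos : BlockwiseGeneralPosition (X * (weightMatrix grp w)⁻¹) grp α) {s : Fin p → ℝ}
    {A : Finset (Fin J)} (hs : s ∈ subgradSpace X grp w)
    (hA : ∀ j ∈ A, blockNorm grp (Real.conjExponent α) s j = 1) :
    LinearIndependent ℝ fun j : A => blockVec X grp w α s j :=
  (linearIndependent_blockVec hα hw hpos hs).comp (fun j : A => ⟨j, hA j j.2⟩)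
    fun _ _ hij => Subtype.ext (congrArg (fun x => x.1) hij)

theorem card_le_of_mem_subgradSpace (hα : 1 < α) (hw : ∀ j, 0 < w j)
    (hpos : BlockwiseGeneralPosition (X * (weightMatrix grp w)⁻¹) grp α) {s : Fin p → ℝ}
    {A : Finset (Fin J)} (hs : s ∈ subgradSpace X grp w)
    (hA : ∀ j ∈ A, blockNorm grp (Real.conjExponent α) s j = 1) : A.card ≤ n := by
  simpa using
    (linearIndependent_blockVec_of_mem hα hw hpos hs hA).fintype_card_le_finrank

theorem mulVec_eq_sum_blockVec (hw : ∀ j, 0 < w j) {s b : Fin p → ℝ} {c : Fin J → ℝ}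
    (hb : ∀ k, b k = c (grp k) * eta α (s k)) :
    X *ᵥ b = ∑ j, (c j * w j) • blockVec X grp w α s j := by
  ext i
  rw [Matrix.mulVec, dotProduct, ← sum_groups grp, Finset.sum_apply]
  refine Finset.sum_congr rfl fun j _ => ?_
  rw [Pi.smul_apply, blockVec, smul_eq_mul, Finset.mul_sum]
  refine Finset.sum_congr rfl fun k hk => ?_
  rw [hb, (Finset.mem_filter.1 hk).2]
  field_simp [(hw j).ne']

/-- The KKT residual `XᵀX β / n + λ W S - Xᵀ y / n` in terms of the residual `y - X β`. -/
theorem kkt_iff {y : Fin n → ℝ} {β S : Fin p → ℝ} :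
    gram X *ᵥ β + lam • (weightMatrix grp w *ᵥ S) = (1 / (n : ℝ)) • (Xᵀ *ᵥ y) ↔
      ∀ k, lam * (w (grp k) * S k) = ((1 / (n : ℝ)) • (Xᵀ *ᵥ (y - X *ᵥ β))) k := by
  rw [gram, Matrix.smul_mulVec, ← Matrix.mulVec_mulVec, Matrix.mulVec_sub, smul_sub,
    ← eq_sub_iff_add_eq', funext_iff]
  simp [weightMatrix, Matrix.mulVec_diagonal]

theorem dataLoss_add (y : Fin n → ℝ) (β d : Fin p → ℝ) :
    1 / (2 * (n : ℝ)) * ∑ i, (y i - (X *ᵥ (β + d)) i) ^ 2 =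
      1 / (2 * (n : ℝ)) * ∑ i, (y i - (X *ᵥ β) i) ^ 2
        - ∑ k, ((1 / (n : ℝ)) • (Xᵀ *ᵥ (y - X *ᵥ β))) k * d k
        + 1 / (2 * (n : ℝ)) * ∑ i, (X *ᵥ d) i ^ 2 := by
  have h : ∑ k, ((1 / (n : ℝ)) • (Xᵀ *ᵥ (y - X *ᵥ β))) k * d k =
      1 / (n : ℝ) * ∑ i, (y i - (X *ᵥ β) i) * (X *ᵥ d) i := by
    change (((1 / (n : ℝ)) • (Xᵀ *ᵥ (y - X *ᵥ β))) ⬝ᵥ d) = 1 / (n : ℝ) * ((y - X *ᵥ β) ⬝ᵥ X *ᵥ d)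
    rw [smul_dotProduct, Matrix.mulVec_transpose, ← Matrix.dotProduct_mulVec, smul_eq_mul]
  rw [h, Matrix.mulVec_add]
  have : ∑ i, (y i - (X *ᵥ β + X *ᵥ d) i) ^ 2 = ∑ i, (y i - (X *ᵥ β) i) ^ 2
      - 2 * ∑ i, (y i - (X *ᵥ β) i) * (X *ᵥ d) i + ∑ i, (X *ᵥ d) i ^ 2 := by
    rw [Finset.mul_sum, ← Finset.sum_sub_distrib, ← Finset.sum_add_distrib]
    refine Finset.sum_congr rfl fun i _ => ?_
    rw [Pi.add_apply]
    ring
  rw [this]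
  have h2 : 1 / (2 * (n : ℝ)) = 1 / n / 2 := by rw [div_div, mul_comm]
  rw [h2]
  ring

theorem loss_le_of_kkt (hα : 1 < α) (hw : ∀ j, 0 < w j) (hlam : 0 < lam) {y : Fin n → ℝ}
    {β S : Fin p → ℝ} (hS : IsDualPair grp α β S)
    (hk : ∀ k, lam * (w (grp k) * S k) = ((1 / (n : ℝ)) • (Xᵀ *ᵥ (y - X *ᵥ β))) k)
    (b : Fin p → ℝ) : loss X grp w α lam y β ≤ loss X grp w α lam y b := by
  have h1 := dataLoss_add (X := X) y β (b - β)
  rw [add_sub_cancel] at h1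
  have h2 : ∑ k, ((1 / (n : ℝ)) • (Xᵀ *ᵥ (y - X *ᵥ β))) k * (b - β) k ≤
      lam * ∑ j, w j * blockNorm grp α b j - lam * ∑ j, w j * blockNorm grp α β j := by
    rw [← mul_sub, ← Finset.sum_sub_distrib, ← sum_groups grp, Finset.mul_sum]
    refine Finset.sum_le_sum fun j _ => ?_
    have : ∑ k with grp k = j, ((1 / (n : ℝ)) • (Xᵀ *ᵥ (y - X *ᵥ β))) k * (b - β) k =
        lam * (w j * (∑ k with grp k = j, S k * b k - ∑ k with grp k = j, S k * β k)) := by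
      rw [← Finset.sum_sub_distrib, Finset.mul_sum, Finset.mul_sum]
      refine Finset.sum_congr rfl fun k hk' => ?_
      rw [← hk, (Finset.mem_filter.1 hk').2, Pi.sub_apply]
      ring
    rw [this, hS.inner_eq hα, ← mul_sub]
    refine mul_le_mul_of_nonneg_left (mul_le_mul_of_nonneg_left ?_ (hw j).le) hlam.le
    linarith [hS.inner_le hα b j]
  have h3 : 0 ≤ 1 / (2 * (n : ℝ)) * ∑ i, (X *ᵥ (b - β)) i ^ 2 := by positivity
  rw [loss, loss, h1]
  linarith

/-- By convexity the KKT equation with a dual pair already implies minimality, so the rest of the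
argument can use KKT alone. -/
theorem isAugmentedSolution_iff (hα : 1 < α) (hw : ∀ j, 0 < w j) (hlam : 0 < lam)
    {y : Fin n → ℝ} {β S : Fin p → ℝ} : IsAugmentedSolution X grp w α lam y β S ↔
      IsDualPair grp α β S ∧
      gram X *ᵥ β + lam • (weightMatrix grp w *ᵥ S) = (1 / (n : ℝ)) • (Xᵀ *ᵥ y) := by
  constructor
  · exact fun h => ⟨(isDualPair_iff hα).2 ⟨h.subgrad_active, h.subgrad_inactive⟩, h.kkt⟩
  · rintro ⟨h, hk⟩
    obtain ⟨h1, h2⟩ := (isDualPair_iff hα).1 h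
    exact ⟨loss_le_of_kkt hα hw hlam h (kkt_iff.1 hk), h1, h2, hk⟩

theorem abs_le_blockNorm {q : ℝ} (hq : 0 < q) (v : Fin p → ℝ) (k : Fin p) :
    |v k| ≤ blockNorm grp q v (grp k) := by
  rw [← Real.rpow_le_rpow_iff (abs_nonneg _) (blockNorm_nonneg _ _ _) hq, blockNorm_rpow hq]
  exact Finset.single_le_sum (f := fun l => |v l| ^ q)
    (fun l _ => Real.rpow_nonneg (abs_nonneg _) _) (by simp)

theorem continuous_loss (hα : 1 < α) :
    Continuous fun b : (Fin n → ℝ) × (Fin p → ℝ) => loss X grp w α lam b.1 b.2 := by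
  have h1 : ∀ j, Continuous fun b : (Fin n → ℝ) × (Fin p → ℝ) => blockNorm grp α b.2 j :=
    fun j => (continuous_blockNorm (by linarith) j).comp continuous_snd
  have h2 : ∀ i, Continuous fun b : (Fin n → ℝ) × (Fin p → ℝ) => (X *ᵥ b.2) i := fun i =>
    (continuous_apply i).comp (Continuous.matrix_mulVec continuous_const continuous_snd)
  unfold loss
  fun_prop

theorem exists_isMinOn_loss (hα : 1 < α) (hw : ∀ j, 0 < w j) (hlam : 0 < lam)
    (y : Fin n → ℝ) :
    ∃ β, ∀ b, loss X grp w α lam y β ≤ loss X grp w α lam y b := by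
  have hc : Continuous (loss X grp w α lam y) :=
    (continuous_loss hα).comp (continuous_const.prodMk continuous_id)
  refine hc.exists_forall_le' 0 ?_
  set C := loss X grp w α lam y 0
  -- The quadratic term need not be coercive, but outside this box the penalty alone exceeds the
  -- loss C at 0.
  let R : Fin p → ℝ := fun k => C / (lam * w (grp k))
  rw [Filter.Eventually, Filter.mem_cocompact]
  refine ⟨Set.Icc (-R) R, isCompact_Icc, fun b hb => ?_⟩
  by_contra hlt
  simp only [Set.mem_ofPred_eq, not_le] at hlt
  refine hb ?_
  have hk : ∀ k, |b k| ≤ R k := fun k => by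
    have hpos : 0 < lam * w (grp k) := mul_pos hlam (hw _)
    rw [le_div_iff₀ hpos]
    have h1 : lam * (w (grp k) * blockNorm grp α b (grp k)) ≤ loss X grp w α lam y b := by
      rw [loss]
      have h2 : w (grp k) * blockNorm grp α b (grp k) ≤ ∑ j, w j * blockNorm grp α b j :=
        Finset.single_le_sum (f := fun j => w j * blockNorm grp α b j)
          (fun j _ => mul_nonneg (hw j).le (blockNorm_nonneg _ _ _)) (Finset.mem_univ _)
      have h3 : 0 ≤ 1 / (2 * (n : ℝ)) * ∑ i, (y i - (X *ᵥ b) i) ^ 2 := by positivity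
      linarith [mul_le_mul_of_nonneg_left h2 hlam.le]
    have h4 := mul_le_mul_of_nonneg_left
      (abs_le_blockNorm (grp := grp) (show 0 < α by linarith) b k) hpos.le
    linarith
  exact ⟨fun k => (abs_le.1 (hk k)).1, fun k => (abs_le.1 (hk k)).2⟩

theorem le_of_forall_le_add_mul {a b Q : ℝ}
    (h : ∀ t, 0 < t → t ≤ 1 → a ≤ b + t * Q) : a ≤ b := by
  have ht : Filter.Tendsto (fun t : ℝ => b + t * Q) (nhdsWithin 0 (Set.Ioi 0)) (nhds b) := by
    have : ContinuousAt (fun t : ℝ => b + t * Q) 0 := by fun_prop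
    simpa using this.tendsto.mono_left nhdsWithin_le_nhds
  refine ge_of_tendsto ht ?_
  filter_upwards [Ioo_mem_nhdsGT (zero_lt_one' ℝ)] with t ht
  exact h t ht.1 ht.2.le

/-- Fermat's rule for the penalized loss. -/
theorem gradient_inner_le (hα : 1 < α) (hw : ∀ j, 0 < w j) (hlam : 0 < lam) {y : Fin n → ℝ}
    {β : Fin p → ℝ} (hmin : ∀ b, loss X grp w α lam y β ≤ loss X grp w α lam y b)
    (b : Fin p → ℝ) :
    ∑ k, ((1 / (n : ℝ)) • (Xᵀ *ᵥ (y - X *ᵥ β))) k * (b - β) k ≤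
      lam * ∑ j, w j * (blockNorm grp α b j - blockNorm grp α β j) := by
  set Q := 1 / (2 * (n : ℝ)) * ∑ i, (X *ᵥ (b - β)) i ^ 2 with hQ
  -- The loss at β is compared with the loss at β + t(b − β). Convexity of the norm and the exact
  -- quadratic expansion leave an error t² Q; dividing by t and letting t → 0 removes it.
  refine le_of_forall_le_add_mul (Q := Q) fun t ht0 ht1 => ?_
  have h1 := dataLoss_add (X := X) y β (t • (b - β))
  have h2 : 1 / (2 * (n : ℝ)) * ∑ i, (X *ᵥ (t • (b - β))) i ^ 2 = t ^ 2 * Q := by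
    rw [hQ, Matrix.mulVec_smul, mul_left_comm]
    congr 1
    rw [Finset.mul_sum]
    refine Finset.sum_congr rfl fun i _ => ?_
    rw [Pi.smul_apply, smul_eq_mul]
    ring
  have h3 : ∑ k, ((1 / (n : ℝ)) • (Xᵀ *ᵥ (y - X *ᵥ β))) k * (t • (b - β)) k =
      t * ∑ k, ((1 / (n : ℝ)) • (Xᵀ *ᵥ (y - X *ᵥ β))) k * (b - β) k := by
    rw [Finset.mul_sum]
    refine Finset.sum_congr rfl fun i _ => ?_
    rw [Pi.smul_apply _ (b - β), smul_eq_mul]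
    ring
  have h4 : ∀ j, blockNorm grp α (β + t • (b - β)) j ≤
      blockNorm grp α β j + t * (blockNorm grp α b j - blockNorm grp α β j) := fun j => by
    have : β + t • (b - β) = (1 - t) • β + t • b := by
      module
    rw [this]
    refine (blockNorm_add_le hα.le _ _ j).trans ?_
    rw [blockNorm_smul (by linarith) (by linarith), blockNorm_smul (by linarith) ht0.le]
    linarith
  have h5 : lam * ∑ j, w j * blockNorm grp α (β + t • (b - β)) j ≤
      lam * ∑ j, w j * blockNorm grp α β j +
        t * (lam * ∑ j, w j * (blockNorm grp α b j - blockNorm grp α β j)) := by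
    have : ∑ j, w j * blockNorm grp α (β + t • (b - β)) j ≤ ∑ j, w j * blockNorm grp α β j +
        t * ∑ j, w j * (blockNorm grp α b j - blockNorm grp α β j) := by
      rw [Finset.mul_sum, ← Finset.sum_add_distrib]
      refine Finset.sum_le_sum fun j _ => ?_
      linarith [mul_le_mul_of_nonneg_left (h4 j) (hw j).le]
    linarith [mul_le_mul_of_nonneg_left this hlam.le]
  have h6 := hmin (β + t • (b - β))
  rw [loss, loss, h1, h2, h3] at h6
  have h7 : 0 ≤ t * (lam * ∑ j, w j * (blockNorm grp α b j - blockNorm grp α β j) + t * Q -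
      ∑ k, ((1 / (n : ℝ)) • (Xᵀ *ᵥ (y - X *ᵥ β))) k * (b - β) k) := by
    linarith
  linarith [nonneg_of_mul_nonneg_right h7 ht0]

/-- The KKT equation forces S: it is the negative gradient of the quadratic term, divided entrywise
by λ w. Fermat's rule then has to show that it is a subgradient. -/
theorem exists_subgradient_of_isMin (hα : 1 < α) (hw : ∀ j, 0 < w j) (hlam : 0 < lam)
    {y : Fin n → ℝ} {β : Fin p → ℝ}
    (hmin : ∀ b, loss X grp w α lam y β ≤ loss X grp w α lam y b) :
    ∃ S, IsAugmentedSolution X grp w α lam y β S := by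
  set grad := (1 / (n : ℝ)) • (Xᵀ *ᵥ (y - X *ᵥ β)) with hgrad
  let S : Fin p → ℝ := fun k => grad k / (lam * w (grp k))
  have hS : ∀ k, lam * (w (grp k) * S k) = grad k := fun k => by
    have := (mul_pos hlam (hw (grp k))).ne'
    rw [← mul_assoc, mul_div_cancel₀ _ this]
  -- Modifying β in the group j alone separates the inequality into one inequality per group.
  have key : ∀ (b : Fin p → ℝ) (j : Fin J), ∑ k with grp k = j, S k * b k -
      ∑ k with grp k = j, S k * β k ≤ blockNorm grp α b j - blockNorm grp α β j := by
    intro b j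
    let b' : Fin p → ℝ := fun k => if grp k = j then b k else β k
    have h := gradient_inner_le hα hw hlam hmin b'
    rw [← hgrad, ← sum_groups grp] at h
    have hl : ∀ i, ∑ k with grp k = i, grad k * (b' - β) k = if i = j then
        lam * (w j * (∑ k with grp k = j, S k * b k - ∑ k with grp k = j, S k * β k))
        else 0 := by
      intro i
      split_ifs with hij
      · subst hij
        rw [← Finset.sum_sub_distrib, Finset.mul_sum, Finset.mul_sum]
        refine Finset.sum_congr rfl fun k hk => ?_
        have hk := (Finset.mem_filter.1 hk).2
        rw [← hS, hk, Pi.sub_apply, show b' k = b k from if_pos hk]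
        ring
      · refine Finset.sum_eq_zero fun k hk => ?_
        have hk := (Finset.mem_filter.1 hk).2
        rw [Pi.sub_apply, show b' k = β k from if_neg (by rw [hk]; exact hij), sub_self, mul_zero]
    have hr : ∀ i, w i * (blockNorm grp α b' i - blockNorm grp α β i) = if i = j then
        w j * (blockNorm grp α b j - blockNorm grp α β j) else 0 := by
      intro i
      split_ifs with hij
      · subst hij
        rw [blockNorm_congr (v := b') (v' := b) fun k hk => if_pos hk]
      · rw [blockNorm_congr (v := b') (v' := β) fun k hk => if_neg (by rw [hk]; exact hij),
          sub_self, mul_zero]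
    simp_rw [hl, hr] at h
    simp only [Finset.sum_ite_eq', Finset.mem_univ, if_true] at h
    exact le_of_mul_le_mul_left (le_of_mul_le_mul_left h hlam) (hw j)
  -- By homogeneity of the norm, the competitors 0 and 2β give the two opposite inequalities.
  have heq : ∀ j, ∑ k with grp k = j, S k * β k = blockNorm grp α β j := by
    intro j
    have hα0 : 0 < α := by linarith
    have h0 := key ((0 : ℝ) • β) j
    have h2 := key ((2 : ℝ) • β) j
    rw [blockNorm_smul hα0 le_rfl] at h0
    rw [blockNorm_smul hα0 zero_le_two] at h2
    simp only [Pi.smul_apply, smul_eq_mul, mul_left_comm _ (2 : ℝ), mul_left_comm _ (0 : ℝ),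
      ← Finset.mul_sum] at h0 h2
    linarith
  refine ⟨S, (isAugmentedSolution_iff hα hw hlam).2
    ⟨isDualPair_of_inner hα heq fun b j => ?_, kkt_iff.2 hS⟩⟩
  linarith [key b j, heq j]

theorem subgradient_mem_subgradSpace (hw : ∀ j, 0 < w j) (hlam : 0 < lam) {y : Fin n → ℝ}
    {β S : Fin p → ℝ}
    (h : gram X *ᵥ β + lam • (weightMatrix grp w *ᵥ S) = (1 / (n : ℝ)) • (Xᵀ *ᵥ y)) :
    S ∈ subgradSpace X grp w := by
  rw [mem_subgradSpace hw]
  refine ⟨(1 / lam) • (1 / (n : ℝ)) • (y - X *ᵥ β), ?_⟩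
  ext k
  have hk := kkt_iff.1 h k
  rw [subgradMap_apply, Matrix.mulVec_smul, Matrix.mulVec_smul, Pi.smul_apply, ← hk, smul_eq_mul]
  field_simp [(hw (grp k)).ne']

/-- Equal fits give equal S by KKT. With S common, X(β − β') = 0 is a linear relation between the
block vectors of S, whose coefficients are w_j times the differences of the block norms. -/
theorem IsAugmentedSolution.unique (hn : 0 < n) (hα : 1 < α) (hw : ∀ j, 0 < w j)
    (hlam : 0 < lam)
    (hpos : BlockwiseGeneralPosition (X * (weightMatrix grp w)⁻¹) grp α) {y : Fin n → ℝ}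
    {β S β' S' : Fin p → ℝ} (h : IsAugmentedSolution X grp w α lam y β S)
    (h' : IsAugmentedSolution X grp w α lam y β' S') : β = β' ∧ S = S' := by
  obtain ⟨hd, hk⟩ := (isAugmentedSolution_iff hα hw hlam).1 h
  obtain ⟨hd', hk'⟩ := (isAugmentedSolution_iff hα hw hlam).1 h'
  have hn' : (0 : ℝ) < n := by exact_mod_cast hn
  have hres := kkt_iff.1 hk
  have hres' := kkt_iff.1 hk'
  have hfit : X *ᵥ β = X *ᵥ β' := by
    -- Subtracting the two KKT equations and pairing with β − β' gives −‖X(β − β')‖² / n, whereas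
    -- monotonicity of subgradients makes the same sum nonnegative.
    have h1 : ∑ k, lam * (w (grp k) * (S k - S' k)) * (β k - β' k) =
        -(1 / (n : ℝ) * ∑ i, (X *ᵥ (β - β')) i ^ 2) := by
      have : ∀ k, lam * (w (grp k) * (S k - S' k)) =
          -((1 / (n : ℝ)) • (Xᵀ *ᵥ (X *ᵥ (β - β')))) k := fun k => by
        have := congrArg₂ (· - ·) (hres k) (hres' k)
        simp only [Matrix.mulVec_sub, Pi.smul_apply, Pi.sub_apply, smul_eq_mul] at this ⊢
        linarith
      simp_rw [this]
      simp_rw [neg_mul, Finset.sum_neg_distrib]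
      congr 1
      change (((1 / (n : ℝ)) • (Xᵀ *ᵥ (X *ᵥ (β - β')))) ⬝ᵥ (β - β')) = _
      rw [smul_dotProduct, Matrix.mulVec_transpose, ← Matrix.dotProduct_mulVec, smul_eq_mul]
      congr 1
      exact Finset.sum_congr rfl fun i _ => (sq _).symm
    have h2 : 0 ≤ ∑ k, lam * (w (grp k) * (S k - S' k)) * (β k - β' k) := by
      rw [← sum_groups grp]
      refine Finset.sum_nonneg fun j _ => ?_
      have : ∑ k with grp k = j, lam * (w (grp k) * (S k - S' k)) * (β k - β' k) =
          lam * w j * ((∑ k with grp k = j, S k * β k - ∑ k with grp k = j, S k * β' k) +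
            (∑ k with grp k = j, S' k * β' k - ∑ k with grp k = j, S' k * β k)) := by
        rw [← Finset.sum_sub_distrib, ← Finset.sum_sub_distrib, ← Finset.sum_add_distrib,
          Finset.mul_sum]
        refine Finset.sum_congr rfl fun k hk => ?_
        rw [(Finset.mem_filter.1 hk).2]
        ring
      rw [this, hd.inner_eq hα, hd'.inner_eq hα]
      refine mul_nonneg (mul_pos hlam (hw j)).le ?_
      linarith [hd.inner_le hα β' j, hd'.inner_le hα β j]
    have h3 : ∑ i, (X *ᵥ (β - β')) i ^ 2 = 0 := by
      refine le_antisymm ?_ (Finset.sum_nonneg fun i _ => sq_nonneg _)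
      have h4 : 1 / (n : ℝ) * ∑ i, (X *ᵥ (β - β')) i ^ 2 ≤ 0 := by linarith
      by_contra hlt
      push Not at hlt
      linarith [mul_pos (one_div_pos.2 hn') hlt]
    rw [Finset.sum_eq_zero_iff_of_nonneg fun i _ => sq_nonneg _] at h3
    ext i
    have := h3 i (Finset.mem_univ i)
    rw [sq_eq_zero_iff, Matrix.mulVec_sub, Pi.sub_apply] at this
    linarith
  have hSS : S = S' := by
    ext k
    have := (hres k).trans ((congrArg (fun v => ((1 / (n : ℝ)) • (Xᵀ *ᵥ (y - v))) k) hfit).trans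
      (hres' k).symm)
    exact mul_left_cancel₀ (hw _).ne' (mul_left_cancel₀ hlam.ne' this)
  subst hSS
  refine ⟨?_, rfl⟩
  have hz : ∀ {b : Fin p → ℝ}, IsDualPair grp α b S → ∀ j,
      blockNorm grp (Real.conjExponent α) S j ≠ 1 → blockNorm grp α b j = 0 := by
    intro b hb j hj
    rw [blockNorm_eq_zero_iff (by linarith)]
    exact fun hmem => hj (hb.norm_eq j hmem)
  have hli := linearIndependent_blockVec hα hw hpos
    (subgradient_mem_subgradSpace hw hlam hk)
  have hsum : ∑ j, ((blockNorm grp α β j - blockNorm grp α β' j) * w j) •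
      blockVec X grp w α S j = 0 := by
    rw [← mulVec_eq_sum_blockVec hw (b := β - β') (c := fun j =>
      blockNorm grp α β j - blockNorm grp α β' j), Matrix.mulVec_sub, hfit, sub_self]
    intro k
    rw [Pi.sub_apply, hd.eq_mul_eta k, hd'.eq_mul_eta k]
    ring
  -- Groups with ‖S_(j)‖_{α*} ≠ 1 are inactive in both solutions, so only linearly independent
  -- vectors remain in the relation.
  have hc : ∀ j, blockNorm grp α β j = blockNorm grp α β' j := by
    intro j
    by_cases hj : blockNorm grp (Real.conjExponent α) S j = 1
    · rw [Fintype.linearIndependent_iff] at hli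
      have := hli (fun j => (blockNorm grp α β j - blockNorm grp α β' j) * w j) (by
        rw [← hsum]
        refine Finset.sum_bij_ne_zero (fun j _ _ => j.1) (fun _ _ _ => Finset.mem_univ _)
          (fun _ _ _ _ _ _ h => Subtype.ext h) (fun j _ hj => ?_) fun _ _ _ => rfl
        refine ⟨⟨j, ?_⟩, Finset.mem_univ _, hj, rfl⟩
        by_contra hne
        rw [hz hd j hne, hz hd' j hne, sub_self, zero_mul, zero_smul] at hj
        exact hj rfl) ⟨j, hj⟩
      have := (mul_eq_zero.1 this).resolve_right (hw j).ne'
      linarith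
    · rw [hz hd j hj, hz hd' j hj]
  ext k
  rw [hd.eq_mul_eta k, hd'.eq_mul_eta k, hc]

theorem existsUnique_isAugmentedSolution (hn : 0 < n) (hα : 1 < α) (hw : ∀ j, 0 < w j)
    (hlam : 0 < lam)
    (hpos : BlockwiseGeneralPosition (X * (weightMatrix grp w)⁻¹) grp α) (y : Fin n → ℝ) :
    ∃! b : (Fin p → ℝ) × (Fin p → ℝ), IsAugmentedSolution X grp w α lam y b.1 b.2 := by
  obtain ⟨β, hβ⟩ := exists_isMinOn_loss (X := X) (grp := grp) hα hw hlam y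
  obtain ⟨S, hS⟩ := exists_subgradient_of_isMin hα hw hlam hβ
  refine ⟨(β, S), hS, fun b hb => ?_⟩
  obtain ⟨h1, h2⟩ := hb.unique hn hα hw hlam hpos hS
  exact Prod.ext h1 h2

theorem IsAugmentedSolution.mem_sampleSpace (hα : 1 < α) (hw : ∀ j, 0 < w j)
    (hlam : 0 < lam)
    (hpos : BlockwiseGeneralPosition (X * (weightMatrix grp w)⁻¹) grp α) {y : Fin n → ℝ}
    {β S : Fin p → ℝ} (h : IsAugmentedSolution X grp w α lam y β S) :
    (activeGroups grp β).card ≤ n ∧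
      S ∈ subgradManifold X grp w α (activeGroups grp β) := by
  obtain ⟨hd, hk⟩ := (isAugmentedSolution_iff hα hw hlam).1 h
  have hS := subgradient_mem_subgradSpace hw hlam hk
  exact ⟨card_le_of_mem_subgradSpace hα hw hpos hS hd.norm_eq, hS, hd.norm_eq,
    fun j _ => hd.norm_le j⟩

/-- Projection along a compact factor is a closed map, so preimages of compact sets are closed; a
closed set is a countable union of its compact intersections with balls. -/
theorem measurable_of_isClosed_graph {Y Z : Type*} [TopologicalSpace Y] [MeasurableSpace Y]
    [BorelSpace Y] [MetricSpace Z] [ProperSpace Z] [Nonempty Z] [MeasurableSpace Z] [BorelSpace Z]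
    {f : Y → Z} (hf : IsClosed {b : Y × Z | f b.1 = b.2}) : Measurable f := by
  have hK : ∀ K : Set Z, IsCompact K → IsClosed (f ⁻¹' K) := by
    intro K hK
    have : CompactSpace K := isCompact_iff_compactSpace.1 hK
    have hcl : IsClosed {b : Y × K | f b.1 = b.2} :=
      hf.preimage (continuous_fst.prodMk (continuous_subtype_val.comp continuous_snd))
    convert isClosedMap_fst_of_compactSpace _ hcl using 1
    ext y
    constructor
    · exact fun hy => ⟨(y, ⟨f y, hy⟩), rfl, rfl⟩
    · rintro ⟨⟨y, k⟩, hyk, rfl⟩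
      change f y ∈ K
      rw [show f y = k from hyk]
      exact k.2
  refine measurable_of_isClosed fun C hC => ?_
  let z : Z := Classical.arbitrary Z
  have : f ⁻¹' C = ⋃ m : ℕ, f ⁻¹' (C ∩ Metric.closedBall z m) := by
    rw [← Set.preimage_iUnion, ← Set.inter_iUnion, Metric.iUnion_closedBall_nat, Set.inter_univ]
  rw [this]
  exact MeasurableSet.iUnion fun m =>
    (hK _ ((isCompact_closedBall z m).inter_left hC)).measurableSet

/-- By uniqueness the graph of y ↦ β is the set of all pairs in which β minimizes the loss for y, an
intersection of closed conditions. -/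
theorem measurable_of_isAugmentedSolution (hn : 0 < n) (hα : 1 < α) (hw : ∀ j, 0 < w j)
    (hlam : 0 < lam)
    (hpos : BlockwiseGeneralPosition (X * (weightMatrix grp w)⁻¹) grp α)
    {B : (Fin n → ℝ) → Fin p → ℝ}
    (hB : ∀ y, ∃ S, IsAugmentedSolution X grp w α lam y (B y) S) : Measurable B := by
  refine measurable_of_isClosed_graph ?_
  have : {b : (Fin n → ℝ) × (Fin p → ℝ) | B b.1 = b.2} =
      ⋂ c : Fin p → ℝ, {b | loss X grp w α lam b.1 b.2 ≤ loss X grp w α lam b.1 c} := by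
    ext ⟨y, β⟩
    simp only [Set.mem_ofPred_eq, Set.mem_iInter]
    obtain ⟨S, hS⟩ := hB y
    constructor
    · rintro rfl
      exact hS.isMin
    · intro h
      obtain ⟨S', hS'⟩ := exists_subgradient_of_isMin hα hw hlam h
      exact (hS.unique hn hα hw hlam hpos hS').1
  rw [this]
  have hc := continuous_loss (X := X) (grp := grp) (w := w) (lam := lam) hα
  have hc' : ∀ c : Fin p → ℝ,
      Continuous fun b : (Fin n → ℝ) × (Fin p → ℝ) => loss X grp w α lam b.1 c :=
    fun c => by
      have hg : Continuous fun b : (Fin n → ℝ) × (Fin p → ℝ) => (b.1, c) := by fun_prop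
      simpa only [Function.comp_def] using hc.comp hg
  refine isClosed_iInter fun c => ?_
  exact isClosed_le hc (hc' c)

theorem measurable_estimator (hn : 0 < n) (hα : 1 < α) (hw : ∀ j, 0 < w j) (hlam : 0 < lam)
    (hpos : BlockwiseGeneralPosition (X * (weightMatrix grp w)⁻¹) grp α)
    {Ω : Type*} [MeasurableSpace Ω] {Y : Ω → Fin n → ℝ} (hY : Measurable Y)
    {βhat S : Ω → Fin p → ℝ}
    (h : ∀ ω, IsAugmentedSolution X grp w α lam (Y ω) (βhat ω) (S ω)) :
    Measurable βhat ∧ Measurable S := by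
  choose b hb _ using existsUnique_isAugmentedSolution (X := X) (grp := grp) hn hα hw hlam hpos
  have hB : Measurable fun y => (b y).1 :=
    measurable_of_isAugmentedSolution hn hα hw hlam hpos fun y => ⟨_, hb y⟩
  have hβ : βhat = fun ω => (b (Y ω)).1 := funext fun ω =>
    ((h ω).unique hn hα hw hlam hpos (hb (Y ω))).1
  have hβm : Measurable βhat := hβ ▸ hB.comp hY
  refine ⟨hβm, measurable_pi_lambda _ fun k => ?_⟩
  -- The KKT equation makes S a continuous function of the response and β, so its measurability
  -- follows from that of β.
  have hS : (fun ω => S ω k) = fun ω =>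
      ((1 / (n : ℝ)) • (Xᵀ *ᵥ (Y ω - X *ᵥ βhat ω))) k / (lam * w (grp k)) := by
    ext ω
    rw [← kkt_iff.1 (h ω).kkt k, ← mul_assoc, mul_div_cancel_left₀ _ (mul_pos hlam (hw _)).ne']
  rw [hS]
  have hc : Continuous fun v : (Fin n → ℝ) × (Fin p → ℝ) =>
      (1 / (n : ℝ)) • (Xᵀ *ᵥ (v.1 - X *ᵥ v.2)) := by fun_prop
  exact ((measurable_pi_apply k).comp (hc.measurable.comp (hY.prodMk hβm))).div_const _

end Solution

/-! ### Local coordinates s_F on M_A. -/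

section Chart

variable {n p J : ℕ} {X : Matrix (Fin n) (Fin p) ℝ} {grp : Fin p → Fin J} {w : Fin J → ℝ}
  {α lam : ℝ} {A : Finset (Fin J)}

theorem isClosed_subgradManifold (hα : 1 < α) :
    IsClosed (subgradManifold X grp w α A) := by
  have hc : ∀ j, Continuous fun s : Fin p → ℝ => blockNorm grp (Real.conjExponent α) s j :=
    fun j => continuous_blockNorm (conjExponent_pos hα) j
  have : subgradManifold X grp w α A = (subgradSpace X grp w : Set (Fin p → ℝ)) ∩
      ((⋂ j ∈ A, {s | blockNorm grp (Real.conjExponent α) s j = 1}) ∩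
        ⋂ j ∉ A, {s | blockNorm grp (Real.conjExponent α) s j ≤ 1}) := by
    ext s
    simp [subgradManifold]
  rw [this]
  refine (Submodule.closed_of_finiteDimensional _).inter (IsClosed.inter ?_ ?_)
  · exact isClosed_biInter fun j _ => isClosed_eq (hc j) continuous_const
  · exact isClosed_biInter fun j _ => isClosed_le (hc j) continuous_const

/-- Linearly independent constraints leave `n - |A|` of the coordinates free. -/
theorem exists_free_coordinates {n p k : ℕ} {ι : Type*} [Fintype ι]
    (hk : k = n - Fintype.card ι) (v : ι → Fin n → ℝ) (hv : LinearIndependent ℝ v)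
    (ℓ : (Fin n → ℝ) →ₗ[ℝ] (Fin p → ℝ)) (hℓ : Function.Injective ℓ) :
    ∃ F : Fin k ↪ Fin p, ∀ d, (∀ j, v j ⬝ᵥ d = 0) → (∀ l, ℓ d (F l) = 0) → d = 0 := by
  classical
  let B : Matrix ι (Fin n) ℝ := Matrix.of v
  let K := LinearMap.ker B.mulVecLin
  have hK : Module.finrank ℝ K = k := by
    have h1 := LinearMap.finrank_range_add_finrank_ker B.mulVecLin
    have h2 : B.rank = Fintype.card ι := LinearIndependent.rank_matrix (M := B) hv
    rw [Matrix.rank] at h2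
    rw [h2, Module.finrank_fin_fun] at h1
    change Module.finrank ℝ (LinearMap.ker B.mulVecLin) = k
    omega
  -- The coordinates of `ℓ`, restricted to the solution space K of the constraints, separate points.
  -- A maximal independent subfamily still does, so it has exactly dim K = k members, and these
  -- indices form F.
  let φ : Fin p → Module.Dual ℝ K := fun i => (LinearMap.proj i ∘ₗ ℓ) ∘ₗ K.subtype
  obtain ⟨κ, a, ha, hspan, hli⟩ := exists_linearIndependent' ℝ φ
  have : Finite κ := Finite.of_injective a ha
  have := Fintype.ofFinite κ
  have hzero : ∀ d : K, (∀ i, φ (a i) d = 0) → d = 0 := by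
    intro d hd
    have hle : Submodule.span ℝ (Set.range (φ ∘ a)) ≤
        LinearMap.ker (Module.Dual.eval ℝ K d) := by
      rw [Submodule.span_le]
      rintro _ ⟨i, rfl⟩
      simpa using hd i
    rw [hspan] at hle
    have hall : ∀ i, φ i d = 0 := fun i => by
      simpa using hle (Submodule.subset_span ⟨i, rfl⟩)
    have : ℓ d = 0 := funext fun i => hall i
    exact Subtype.ext (hℓ (by rw [this]; simp))
  have hcard : Fintype.card κ = k := by
    refine le_antisymm ?_ ?_
    · have := hli.fintype_card_le_finrank
      rwa [Subspace.dual_finrank_eq, hK] at this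
    · have hinj : Function.Injective (LinearMap.pi fun i => φ (a i) : K →ₗ[ℝ] (κ → ℝ)) := by
        rw [← LinearMap.ker_eq_bot, LinearMap.ker_eq_bot']
        exact fun d hd => hzero d fun i => congrFun hd i
      have := LinearMap.finrank_le_finrank_of_injective hinj
      rwa [hK, Module.finrank_fintype_fun_eq_card] at this
  let e : Fin k ≃ κ := (Fintype.equivFinOfCardEq hcard).symm
  refine ⟨e.toEmbedding.trans ⟨a, ha⟩, fun d h1 h2 => ?_⟩
  have hd : d ∈ K := by
    rw [LinearMap.mem_ker]
    exact funext h1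
  have := hzero ⟨d, hd⟩ fun i => by
    have := h2 (e.symm i)
    simpa [φ] using this
  exact congrArg Subtype.val this

/-- The defining equations of `M_A` together with the coordinates `s_F`, as a function of `z`
with `s = W⁻¹ Xᵀ z`. -/
noncomputable def chartMap (X : Matrix (Fin n) (Fin p) ℝ) (grp : Fin p → Fin J)
    (w : Fin J → ℝ) (α : ℝ) (A : Finset (Fin J)) {k : ℕ} (F : Fin k ↪ Fin p) (z : Fin n → ℝ) :
    (A → ℝ) × (Fin k → ℝ) :=
  (fun j => ∑ l with grp l = j, |subgradMap X grp w z l| ^ Real.conjExponent α,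
    fun l => subgradMap X grp w z (F l))

/-- The derivative of `chartMap`. -/
noncomputable def chartDeriv (X : Matrix (Fin n) (Fin p) ℝ) (grp : Fin p → Fin J)
    (w : Fin J → ℝ) (α : ℝ) (A : Finset (Fin J)) {k : ℕ} (F : Fin k ↪ Fin p) (z : Fin n → ℝ) :
    (Fin n → ℝ) →L[ℝ] (A → ℝ) × (Fin k → ℝ) :=
  (ContinuousLinearMap.pi fun j : A => ∑ l with grp l = j,
    (Real.conjExponent α * eta α (subgradMap X grp w z l)) •
      (ContinuousLinearMap.proj l ∘L (subgradMap X grp w).toContinuousLinearMap)).prod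
  (ContinuousLinearMap.pi fun l =>
    ContinuousLinearMap.proj (F l) ∘L (subgradMap X grp w).toContinuousLinearMap)

theorem chartDeriv_apply {k : ℕ} (F : Fin k ↪ Fin p) (z d : Fin n → ℝ) :
    chartDeriv X grp w α A F z d =
      (fun j : A => Real.conjExponent α * ∑ l with grp l = j,
        eta α (subgradMap X grp w z l) * subgradMap X grp w d l,
      fun l => subgradMap X grp w d (F l)) := by
  ext j
  · simp [chartDeriv, Finset.mul_sum, mul_assoc]
  · simp [chartDeriv]

theorem hasStrictFDerivAt_chartMap (hα : 1 < α) {k : ℕ} (F : Fin k ↪ Fin p) (z : Fin n → ℝ) :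
    HasStrictFDerivAt (chartMap X grp w α A F) (chartDeriv X grp w α A F z) z := by
  have hc : ∀ l, HasStrictFDerivAt (fun z => subgradMap X grp w z l)
      (ContinuousLinearMap.proj l ∘L (subgradMap X grp w).toContinuousLinearMap) z := fun l =>
    (ContinuousLinearMap.proj (R := ℝ) (φ := fun _ : Fin p => ℝ) l ∘L
      (subgradMap X grp w).toContinuousLinearMap).hasStrictFDerivAt
  refine HasStrictFDerivAt.prodMk ?_ ?_
  · refine hasStrictFDerivAt_pi.2 fun j => HasStrictFDerivAt.fun_sum fun l _ => ?_
    exact (hasStrictDerivAt_abs_rpow_conjExponent hα _).comp_hasStrictFDerivAt z (hc l)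
  · exact hasStrictFDerivAt_pi.2 fun l => hc (F l)

/-- Invertibility of the derivative is then an open condition in z, so the F found at one point
serves at all nearby ones. -/
theorem continuous_chartDeriv (hα : 1 < α) {k : ℕ} (F : Fin k ↪ Fin p) :
    Continuous (chartDeriv X grp w α A F) := by
  have hℓ : Continuous (subgradMap X grp w) :=
    (subgradMap X grp w).toContinuousLinearMap.continuous
  rw [continuous_clm_apply]
  intro d
  simp_rw [chartDeriv_apply]
  refine Continuous.prodMk (continuous_pi fun j => ?_) continuous_const
  refine continuous_const.mul (continuous_finsetSum _ fun l _ => ?_)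
  exact ((continuous_eta hα).comp ((continuous_apply l).comp hℓ)).mul continuous_const

/-- Tangent vectors are the images of the d whose constraint components in the chart derivative
vanish; inverting that derivative on (0, c) produces T c. -/
theorem exists_isTangentMatrix (hα : 1 < α) (hw : ∀ j, 0 < w j) (F : Fin (n - A.card) ↪ Fin p)
    {z : Fin n → ℝ} (e : (Fin n → ℝ) ≃L[ℝ] (A → ℝ) × (Fin (n - A.card) → ℝ))
    (he : (e : (Fin n → ℝ) →L[ℝ] (A → ℝ) × (Fin (n - A.card) → ℝ)) =
      chartDeriv X grp w α A F z) :
    ∃ T, IsTangentMatrix X grp w α A (subgradMap X grp w z) F T := by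
  have hq := (conjExponent_pos hα).ne'
  have hed : ∀ d, e d = chartDeriv X grp w α A F z d := fun d => congrArg (fun f => f d) he
  refine ⟨LinearMap.toMatrix' (subgradMap X grp w ∘ₗ e.symm.toLinearMap ∘ₗ
    LinearMap.inr ℝ (A → ℝ) (Fin (n - A.card) → ℝ)), ?_, ?_, ?_⟩
  · intro c
    rw [LinearMap.toMatrix'_mulVec]
    refine ⟨(mem_subgradSpace hw).2 ⟨_, rfl⟩, fun j hj => ?_⟩
    have h1 := hed (e.symm (0, c))
    rw [e.apply_symm_apply, chartDeriv_apply] at h1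
    have h2 := congrFun (congrArg Prod.fst h1) ⟨j, hj⟩
    exact (mul_eq_zero.1 h2.symm).resolve_left hq
  · intro c l
    rw [LinearMap.toMatrix'_mulVec]
    have h1 := hed (e.symm (0, c))
    rw [e.apply_symm_apply, chartDeriv_apply] at h1
    exact (congrFun (congrArg Prod.snd h1) l).symm
  · rintro d ⟨hd, hd'⟩
    rw [LinearMap.toMatrix'_mulVec]
    obtain ⟨y, rfl⟩ := (mem_subgradSpace hw).1 hd
    have h1 : e y = (0, fun l => subgradMap X grp w y (F l)) := by
      rw [hed, chartDeriv_apply]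
      ext j
      · change _ * _ = (0 : ℝ)
        rw [hd' j j.2, mul_zero]
      · rfl
    have h2 : e.symm (0, fun l => subgradMap X grp w y (F l)) = y := by
      rw [← h1, e.symm_apply_apply]
    exact (congrArg (subgradMap X grp w) h2).symm

/-- The constraints together with suitable coordinates s_F have an invertible derivative in z, since
the constraint gradients are multiples of the independent block vectors and F is chosen to complete
them. The inverse map on the level where all constraints equal 1 is the parameterization. -/
theorem exists_local_coordinates (hnp : n ≤ p) (hX : ColumnsIndependent X) (hα : 1 < α)
    (hw : ∀ j, 0 < w j) (hpos : BlockwiseGeneralPosition (X * (weightMatrix grp w)⁻¹) grp α)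
    (hA : A.card ≤ n) {s : Fin p → ℝ} (hs : s ∈ subgradManifold X grp w α A) :
    ∃ (F : Fin (n - A.card) ↪ Fin p) (U : Set (Fin p → ℝ))
      (Δ : Set (Fin (n - A.card) → ℝ)) (Φ : (Fin (n - A.card) → ℝ) → Fin p → ℝ)
      (Φ' : (Fin (n - A.card) → ℝ) → (Fin (n - A.card) → ℝ) →L[ℝ] (Fin p → ℝ)),
      IsOpen U ∧ s ∈ U ∧ IsParameterization X grp w α A Δ Φ Φ' ∧
      Φ '' Δ = subgradManifold X grp w α A ∩ U ∧
      (∀ u ∈ Δ, ∀ l, Φ u (F l) = u l) ∧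
      ∀ u ∈ Δ, ∃ T, IsTangentMatrix X grp w α A (Φ u) F T := by
  have hq := conjExponent_pos hα
  obtain ⟨z, rfl⟩ := (mem_subgradSpace hw).1 hs.1
  have hinj := subgradMap_injective (grp := grp) hnp hX hw
  obtain ⟨F, hF⟩ := exists_free_coordinates (k := n - A.card) (by rw [Fintype.card_coe])
    (fun j : A => blockVec X grp w α (subgradMap X grp w z) j)
    (linearIndependent_blockVec_of_mem hα hw hpos hs.1 hs.2.1) _ hinj
  have hGinj : Function.Injective (chartDeriv X grp w α A F z) := by
    rw [injective_iff_map_eq_zero]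
    intro d hd
    rw [chartDeriv_apply] at hd
    refine hF d (fun j => ?_) fun l => congrFun (congrArg Prod.snd hd) l
    rw [blockVec_dotProduct]
    exact (mul_eq_zero.1 (congrFun (congrArg Prod.fst hd) j)).resolve_left hq.ne'
  have hdim : Module.finrank ℝ (Fin n → ℝ) =
      Module.finrank ℝ ((A → ℝ) × (Fin (n - A.card) → ℝ)) := by
    simp [hA]
  let e₀ : (Fin n → ℝ) ≃L[ℝ] (A → ℝ) × (Fin (n - A.card) → ℝ) :=
    (LinearMap.linearEquivOfInjective (chartDeriv X grp w α A F z).toLinearMap hGinj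
      hdim).toContinuousLinearEquiv
  have he₀ : (e₀ : (Fin n → ℝ) →L[ℝ] (A → ℝ) × (Fin (n - A.card) → ℝ)) =
      chartDeriv X grp w α A F z := by
    ext1 d
    rfl
  have hstrict := hasStrictFDerivAt_chartMap (X := X) (grp := grp) (w := w) (A := A) hα F z
  rw [← he₀] at hstrict
  let h := hstrict.toOpenPartialHomeomorph (chartMap X grp w α A F)
  have hh : ∀ y, h y = chartMap X grp w α A F y := fun y => rfl
  let I : Set (Fin n → ℝ) := {y | ∃ e : (Fin n → ℝ) ≃L[ℝ] (A → ℝ) × (Fin (n - A.card) → ℝ),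
    (e : (Fin n → ℝ) →L[ℝ] (A → ℝ) × (Fin (n - A.card) → ℝ)) = chartDeriv X grp w α A F y}
  have hI : IsOpen I := (ContinuousLinearEquiv.isOpen (𝕜 := ℝ)).preimage
    (continuous_chartDeriv (X := X) (grp := grp) (w := w) (A := A) hα F)
  obtain ⟨L, hL⟩ := LinearMap.exists_leftInverse_of_injective (subgradMap X grp w)
    (LinearMap.ker_eq_bot.2 hinj)
  have hL' : ∀ y, L (subgradMap X grp w y) = y := fun y => congrArg (fun f => f y) hL
  -- A left inverse of z ↦ W⁻¹ Xᵀ z extends a neighbourhood of z to an open set of ℝᵖ. The factor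
  -- `I` keeps the chart derivative invertible at every point, as the tangent matrices require.
  let U : Set (Fin p → ℝ) := L ⁻¹' (h.source ∩ I)
  have hU : IsOpen U :=
    (h.open_source.inter hI).preimage L.toContinuousLinearMap.continuous
  let N := subgradManifold X grp w α A ∩ U
  let c : (Fin p → ℝ) → Fin (n - A.card) → ℝ := fun s l => s (F l)
  let Φ : (Fin (n - A.card) → ℝ) → Fin p → ℝ := fun u => subgradMap X grp w (h.symm (1, u))
  have hNz : ∀ s ∈ N, ∃ y ∈ h.source ∩ I, subgradMap X grp w y = s ∧ h y = (1, c s) := by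
    rintro s ⟨hsM, hsU⟩
    obtain ⟨y, rfl⟩ := (mem_subgradSpace hw).1 hsM.1
    have hy : y ∈ h.source ∩ I := by
      have : L (subgradMap X grp w y) ∈ h.source ∩ I := hsU
      rwa [hL'] at this
    refine ⟨y, hy, rfl, ?_⟩
    rw [hh]
    ext j
    · exact (blockNorm_eq_one_iff hq _ _).1 (hsM.2.1 j j.2)
    · rfl
  have hΦ : ∀ s ∈ N, Φ (c s) = s := by
    intro s hsN
    obtain ⟨y, hy, rfl, hhy⟩ := hNz s hsN
    change subgradMap X grp w (h.symm (1, c (subgradMap X grp w y))) = _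
    rw [← hhy, h.left_inv hy.1]
  have hΦd : ∀ u ∈ c '' N, DifferentiableAt ℝ Φ u := by
    rintro _ ⟨s, hsN, rfl⟩
    obtain ⟨y, ⟨hy, e, he⟩, rfl, hhy⟩ := hNz s hsN
    have hsymm : HasFDerivAt h.symm (e.symm : _ →L[ℝ] _) (1, c (subgradMap X grp w y)) := by
      rw [← hhy]
      refine h.hasFDerivAt_symm (h.map_source hy) ?_
      rw [h.left_inv hy, he]
      exact (hasStrictFDerivAt_chartMap hα F y).hasFDerivAt
    exact (subgradMap X grp w).toContinuousLinearMap.differentiableAt.comp _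
      (hsymm.differentiableAt.comp _
        ((differentiableAt_const (1 : A → ℝ)).prodMk differentiableAt_id))
  refine ⟨F, U, c '' N, Φ, fun u => fderiv ℝ Φ u, hU, ?_, ⟨?_, ?_, ?_, ?_⟩, ?_, ?_, ?_⟩
  · change L (subgradMap X grp w z) ∈ h.source ∩ I
    rw [hL']
    exact ⟨hstrict.mem_toOpenPartialHomeomorph_source, e₀, he₀⟩
  -- The inequalities for j ∉ A may be active, so Δ need not be open; it is measurable as an
  -- injective continuous image of a Borel set.
  · refine ((isClosed_subgradManifold hα).measurableSet.inter
      hU.measurableSet).image_of_continuousOn_injOn ?_ ?_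
    · exact (continuous_pi fun l => continuous_apply (F l)).continuousOn
    · intro s hsN s' hsN' hss'
      rw [← hΦ s hsN, ← hΦ s' hsN']
      exact congrArg Φ hss'
  · rintro _ ⟨s, hsN, rfl⟩ _ ⟨s', hsN', rfl⟩ hss'
    rw [hΦ s hsN, hΦ s' hsN'] at hss'
    rw [hss']
  · rintro _ ⟨s, hsN, rfl⟩
    rw [hΦ s hsN]
    exact hsN.1
  · exact fun u hu => (hΦd u hu).hasFDerivAt.hasFDerivWithinAt
  · rw [Set.image_image]
    exact (Set.image_congr hΦ).trans (Set.image_id' N)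
  · rintro _ ⟨s, hsN, rfl⟩ l
    rw [hΦ s hsN]
  · rintro _ ⟨s, hsN, rfl⟩
    rw [hΦ s hsN]
    obtain ⟨y, ⟨-, e, he⟩, rfl, -⟩ := hNz s hsN
    exact exists_isTangentMatrix hα hw F e he

end Chart

/-! ### Change of variables on countably many pieces. -/

section AreaFormula

variable {E : Type*} [NormedAddCommGroup E] [NormedSpace ℝ E] [FiniteDimensional ℝ E]
  [MeasurableSpace E] [BorelSpace E]

/-- The area formula for a map that is differentiable on each piece of a countable partition. -/
theorem lintegral_image_iUnion {ι : Type*} [Countable ι] (μ : Measure E) [μ.IsAddHaarMeasure]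
    {f : E → E} {f' : E → E →L[ℝ] E} {t : ι → Set E} (ht : ∀ i, MeasurableSet (t i))
    (hdisj : Pairwise (Function.onFun Disjoint t))
    (hf' : ∀ i, ∀ x ∈ t i, HasFDerivWithinAt f (f' x) (t i) x)
    (hf : Set.InjOn f (⋃ i, t i)) {g : E → ℝ≥0∞} (hg : Measurable g) :
    MeasurableSet (f '' ⋃ i, t i) ∧
    AEMeasurable (fun x => ENNReal.ofReal |(f' x).det| * g (f x)) (μ.restrict (⋃ i, t i)) ∧
    ∫⁻ x in f '' ⋃ i, t i, g x ∂μ =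
      ∫⁻ x in ⋃ i, t i, ENNReal.ofReal |(f' x).det| * g (f x) ∂μ := by
  have hinj : ∀ i, Set.InjOn f (t i) := fun i => hf.mono (Set.subset_iUnion t i)
  have hcont : ∀ i, ContinuousOn f (t i) := fun i x hx => (hf' i x hx).continuousWithinAt
  have himg : ∀ i, MeasurableSet (f '' t i) := fun i =>
    (ht i).image_of_continuousOn_injOn (hcont i) (hinj i)
  refine ⟨?_, ?_, ?_⟩
  · rw [Set.image_iUnion]
    exact MeasurableSet.iUnion himg
  · refine (aemeasurable_iUnion_iff (μ := μ)).2 fun i => ?_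
    exact (aemeasurable_ofReal_abs_det_fderivWithin μ (ht i) (hf' i)).mul
      (hg.comp_aemeasurable ((hcont i).aemeasurable (ht i)))
  · rw [Set.image_iUnion, lintegral_iUnion himg, lintegral_iUnion ht hdisj]
    · exact tsum_congr fun i =>
        lintegral_image_eq_lintegral_abs_det_fderiv_mul μ (ht i) (hf' i) (hinj i) g
    · intro i j hij
      rw [Function.onFun, Set.disjoint_left]
      rintro _ ⟨x, hx, rfl⟩ ⟨x', hx', hxx⟩
      have := hf (Set.mem_iUnion.2 ⟨j, hx'⟩) (Set.mem_iUnion.2 ⟨i, hx⟩) hxx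
      subst this
      exact Set.disjoint_left.1 (hdisj hij) hx hx'

/-- A derivative within `s` of a function that is constant on `s` vanishes almost everywhere. -/
theorem ae_hasFDerivWithinAt_const_eq_zero (μ : Measure E) [μ.IsAddHaarMeasure] {s : Set E}
    (hs : MeasurableSet s) {φ : E → ℝ} {φ' : E → E →L[ℝ] ℝ} {c : ℝ} (hc : ∀ x ∈ s, φ x = c)
    (hφ : ∀ x ∈ s, HasFDerivWithinAt φ (φ' x) s x) : ∀ᵐ x ∂μ.restrict s, φ' x = 0 := by
  rcases subsingleton_or_nontrivial E with hE | hE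
  · refine Filter.Eventually.of_forall fun x => ?_
    ext y
    rw [Subsingleton.elim y 0, map_zero, map_zero]
  obtain ⟨e, he⟩ := exists_ne (0 : E)
  have happ : ApproximatesLinearOn (fun _ : E => (0 : E)) (0 : E →L[ℝ] E) s 0 := by
    intro x _ y _
    simp
  -- On s the map (φ − c) • e is the zero map, so `(φ' x).smulRight e` is a derivative of 0 within
  -- s. The zero map is approximated by the linear map 0 with constant 0, and almost everywhere a
  -- derivative within s lies within that constant of it.
  have hd : ∀ x ∈ s, HasFDerivWithinAt (fun _ : E => (0 : E)) ((φ' x).smulRight e) s x := by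
    intro x hx
    have := ((hφ x hx).sub_const c).smul_const e
    refine this.congr (fun y hy => ?_) ?_
    · simp [hc y hy]
    · simp [hc x hx]
  filter_upwards [happ.norm_fderiv_sub_le μ hs _ hd] with x hx
  rw [sub_zero, nonpos_iff_eq_zero, nnnorm_eq_zero] at hx
  ext v
  have := congrArg (fun f => f v) hx
  simpa [he] using this

end AreaFormula

/-! ### The map H̃_A, its inverse and its Jacobian. -/

section Law

variable {n p J : ℕ} {X : Matrix (Fin n) (Fin p) ℝ} {grp : Fin p → Fin J} {w : Fin J → ℝ}
  {α lam : ℝ} {A : Finset (Fin J)} {β₀ : Fin p → ℝ}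

/-- `Xᵀ` has full column rank, so `(Xᵀ)⁺` is a left inverse. -/
theorem pinv_transpose_mul (hnp : n ≤ p) (hX : ColumnsIndependent X) : pinv Xᵀ * Xᵀ = 1 := by
  have hinj : Function.Injective (X * Xᵀ).mulVec := by
    rw [← Matrix.coe_mulVecLin, injective_iff_map_eq_zero]
    intro z hz
    rw [Matrix.mulVecLin_apply, ← Matrix.mulVec_mulVec] at hz
    refine transpose_mulVec_injective hnp hX ?_
    rw [← dotProduct_self_eq_zero]
    conv_lhs => arg 1; rw [Matrix.mulVec_transpose]
    rw [← Matrix.dotProduct_mulVec, hz, dotProduct_zero]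
  have hunit := (Matrix.isUnit_iff_isUnit_det _).1 (Matrix.mulVec_injective_iff_isUnit.1 hinj)
  -- With X Xᵀ invertible, (X Xᵀ)⁻¹ X solves the Penrose equations, and their uniqueness identifies
  -- it with the chosen pseudo-inverse.
  have hMP : IsMoorePenrose Xᵀ ((X * Xᵀ)⁻¹ * X) := by
    have h1 : (X * Xᵀ)⁻¹ * X * Xᵀ = 1 := by
      rw [Matrix.mul_assoc, Matrix.nonsing_inv_mul _ hunit]
    refine ⟨?_, ?_, ?_, ?_⟩
    · rw [Matrix.mul_assoc, h1, Matrix.mul_one]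
    · rw [h1, Matrix.one_mul]
    · rw [Matrix.transpose_mul, Matrix.transpose_mul, Matrix.transpose_transpose,
        Matrix.transpose_nonsing_inv, Matrix.transpose_mul, Matrix.transpose_transpose,
        Matrix.mul_assoc]
    · rw [h1, Matrix.transpose_one]
  have hpinv : IsMoorePenrose Xᵀ (pinv Xᵀ) := Classical.epsilon_spec ⟨_, hMP⟩
  rw [hpinv.unique hMP, Matrix.mul_assoc, Matrix.nonsing_inv_mul _ hunit]

/-- The vector with blocks `r_j η(s_(j))`. -/
noncomputable def primal (grp : Fin p → Fin J) (α : ℝ) (A : Finset (Fin J)) (r : A → ℝ)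
    (s : Fin p → ℝ) (k : Fin p) : ℝ :=
  extendZero A r (grp k) * eta α (s k)

theorem mapH_eq (r : A → ℝ) (s : Fin p → ℝ) : mapH X grp w α lam β₀ A r s =
    gram X *ᵥ primal grp α A r s + lam • (weightMatrix grp w *ᵥ s) - gram X *ᵥ β₀ := by
  rw [mapH]
  congr 2
  ext i
  rw [Matrix.mulVec, dotProduct, ← sum_groups grp, Finset.sum_apply]
  have h : ∀ j, ∑ k with grp k = j, gram X i k * primal grp α A r s k =
      extendZero A r j * gramEta X grp α s i j := by
    intro j
    rw [gramEta, Matrix.of_apply, Finset.mul_sum]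
    refine Finset.sum_congr rfl fun k hk => ?_
    rw [primal, (Finset.mem_filter.1 hk).2]
    ring
  simp_rw [h]
  rw [← Finset.sum_subset (Finset.subset_univ A), ← Finset.sum_coe_sort A]
  · refine Finset.sum_congr rfl fun j _ => ?_
    simp [extendZero]
  · intro j _ hj
    simp [extendZero, hj]

theorem mapH_eq_transpose_mulVec (hw : ∀ j, 0 < w j) (r : A → ℝ) {s : Fin p → ℝ}
    (hs : s ∈ subgradSpace X grp w) : ∃ z, mapH X grp w α lam β₀ A r s = Xᵀ *ᵥ z := by
  obtain ⟨z, rfl⟩ := (mem_subgradSpace hw).1 hs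
  have hz : weightMatrix grp w *ᵥ subgradMap X grp w z = Xᵀ *ᵥ z := by
    ext k
    rw [weightMatrix, Matrix.mulVec_diagonal, subgradMap_apply, ← mul_assoc,
      mul_inv_cancel₀ (hw _).ne', one_mul]
  refine ⟨(1 / (n : ℝ)) • (X *ᵥ (primal grp α A r (subgradMap X grp w z) - β₀)) + lam • z, ?_⟩
  rw [mapH_eq, hz, Matrix.mulVec_add, Matrix.mulVec_smul, Matrix.mulVec_smul,
    Matrix.mulVec_mulVec, gram, Matrix.smul_mulVec, Matrix.smul_mulVec, Matrix.mulVec_sub,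
    smul_sub]
  abel

/-- For s in 𝒱 the vector H_A lies in the range of Xᵀ, on which Xᵀ (Xᵀ)⁺ is the identity. So passing
from ℝᵖ to ℝⁿ loses nothing. -/
theorem transpose_mulVec_mapHTilde (hnp : n ≤ p) (hX : ColumnsIndependent X)
    (hw : ∀ j, 0 < w j) (r : A → ℝ) {s : Fin p → ℝ} (hs : s ∈ subgradSpace X grp w) :
    Xᵀ *ᵥ mapHTilde X grp w α lam β₀ A r s = √(n : ℝ) • mapH X grp w α lam β₀ A r s := by
  obtain ⟨z, hz⟩ := mapH_eq_transpose_mulVec (α := α) (lam := lam) (β₀ := β₀) hw r hs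
  rw [mapHTilde, hz, Matrix.mulVec_mulVec _ (pinv Xᵀ), pinv_transpose_mul hnp hX,
    Matrix.one_mulVec, Matrix.mulVec_smul]

theorem blockNorm_primal (hα : 1 < α) {r : A → ℝ} (hr : ∀ j, 0 < r j) {s : Fin p → ℝ}
    (hs : ∀ j ∈ A, blockNorm grp (Real.conjExponent α) s j = 1) (j : Fin J) :
    blockNorm grp α (primal grp α A r s) j = extendZero A r j := by
  have hα0 : 0 < α := by linarith
  have hnn : 0 ≤ extendZero A r j := by
    unfold extendZero
    split_ifs with h
    · exact (hr _).le
    · exact le_rfl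
  rw [blockNorm_congr (v' := extendZero A r j • fun k => eta α (s k)) fun k hk => by
    rw [primal, hk]; rfl, blockNorm_smul hα0 hnn]
  by_cases hj : j ∈ A
  · rw [blockNorm_eta hα (hs j hj), mul_one]
  · rw [extendZero, dif_neg hj, zero_mul]

theorem activeGroups_primal (hα : 1 < α) {r : A → ℝ} (hr : ∀ j, 0 < r j) {s : Fin p → ℝ}
    (hs : ∀ j ∈ A, blockNorm grp (Real.conjExponent α) s j = 1) :
    activeGroups grp (primal grp α A r s) = A := by
  ext j
  rw [← blockNorm_pos_iff (show 0 < α by linarith), blockNorm_primal hα hr hs, extendZero]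
  split_ifs with h
  · simp [h, hr]
  · simp [h]

/-- The response is chosen so that Xᵀ y / n = Ψ β₀ + H_A, which is the KKT equation for β_(j) = r_j
η(s_(j)). Hence every point of Ω_A is attained. -/
theorem isAugmentedSolution_primal (hn : 0 < n) (hnp : n ≤ p) (hX : ColumnsIndependent X)
    (hα : 1 < α) (hw : ∀ j, 0 < w j) (hlam : 0 < lam) {r : A → ℝ} (hr : ∀ j, 0 < r j)
    {s : Fin p → ℝ} (hs : s ∈ subgradManifold X grp w α A) :
    IsAugmentedSolution X grp w α lam
      (X *ᵥ β₀ + √(n : ℝ) • mapHTilde X grp w α lam β₀ A r s) (primal grp α A r s) s := by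
  have hn' : (0 : ℝ) < n := by exact_mod_cast hn
  obtain ⟨hsV, hs1, hs2⟩ := hs
  rw [isAugmentedSolution_iff hα hw hlam]
  refine ⟨⟨fun j => ?_, ?_, fun k => ?_⟩, ?_⟩
  · by_cases hj : j ∈ A
    · exact (hs1 j hj).le
    · exact hs2 j hj
  · rwa [activeGroups_primal hα hr hs1]
  · rw [blockNorm_primal hα hr hs1, primal]
  · rw [Matrix.mulVec_add, Matrix.mulVec_smul, transpose_mulVec_mapHTilde hnp hX hw r hsV,
      smul_smul, Real.mul_self_sqrt hn'.le, smul_add, smul_smul, one_div_mul_cancel hn'.ne',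
      one_smul, mapH_eq, Matrix.mulVec_mulVec, gram, Matrix.smul_mulVec, Matrix.smul_mulVec]
    abel

theorem mapHTilde_of_isAugmentedSolution (hn : 0 < n) (hnp : n ≤ p) (hX : ColumnsIndependent X)
    (hα : 1 < α) (hw : ∀ j, 0 < w j) (hlam : 0 < lam) {e : Fin n → ℝ} {β S : Fin p → ℝ}
    (h : IsAugmentedSolution X grp w α lam (X *ᵥ β₀ + e) β S) (hA : activeGroups grp β = A) :
    mapHTilde X grp w α lam β₀ A (fun j => blockNorm grp α β j) S = (1 / √(n : ℝ)) • e := by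
  have hn' : (0 : ℝ) < n := by exact_mod_cast hn
  obtain ⟨hd, hk⟩ := (isAugmentedSolution_iff hα hw hlam).1 h
  have hprimal : primal grp α A (fun j => blockNorm grp α β j) S = β := by
    ext k
    rw [hd.eq_mul_eta k, primal, extendZero]
    split_ifs with hj
    · rfl
    · rw [← hA] at hj
      rw [(blockNorm_eq_zero_iff (by linarith)).2 hj]
  have hH : mapH X grp w α lam β₀ A (fun j => blockNorm grp α β j) S =
      Xᵀ *ᵥ ((1 / (n : ℝ)) • e) := by
    rw [mapH_eq, hprimal, hk, Matrix.mulVec_add, Matrix.mulVec_mulVec, gram, Matrix.smul_mulVec,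
      Matrix.mulVec_smul, smul_add]
    abel
  rw [mapHTilde, hH, Matrix.mulVec_mulVec, pinv_transpose_mul hnp hX, Matrix.one_mulVec,
    smul_smul]
  congr 1
  rw [mul_one_div, Real.sqrt_div_self', one_div]

/-- Points with the same image are augmented solutions for the same response, so uniqueness applies,
and r is recovered as the block norms. -/
theorem mapHTilde_injective (hn : 0 < n) (hnp : n ≤ p) (hX : ColumnsIndependent X)
    (hα : 1 < α) (hw : ∀ j, 0 < w j) (hlam : 0 < lam)
    (hpos : BlockwiseGeneralPosition (X * (weightMatrix grp w)⁻¹) grp α) {r r' : A → ℝ}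
    (hr : ∀ j, 0 < r j) (hr' : ∀ j, 0 < r' j) {s s' : Fin p → ℝ}
    (hs : s ∈ subgradManifold X grp w α A) (hs' : s' ∈ subgradManifold X grp w α A)
    (h : mapHTilde X grp w α lam β₀ A r s = mapHTilde X grp w α lam β₀ A r' s') :
    r = r' ∧ s = s' := by
  have h1 := isAugmentedSolution_primal (β₀ := β₀) hn hnp hX hα hw hlam hr hs
  have h2 := isAugmentedSolution_primal (β₀ := β₀) hn hnp hX hα hw hlam hr' hs'
  rw [h] at h1
  obtain ⟨h3, h4⟩ := h1.unique hn hα hw hlam hpos h2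
  refine ⟨funext fun j => ?_, h4⟩
  have h5 := blockNorm_primal hα hr hs.2.1 j
  rw [h3, blockNorm_primal hα hr' hs'.2.1 j] at h5
  simpa [extendZero] using h5.symm

/-- The event that the estimator lies in a piece of the sample space, in terms of the error. -/
theorem estimator_mem_iff (hn : 0 < n) (hnp : n ≤ p) (hX : ColumnsIndependent X)
    (hα : 1 < α) (hw : ∀ j, 0 < w j) (hlam : 0 < lam)
    (hpos : BlockwiseGeneralPosition (X * (weightMatrix grp w)⁻¹) grp α) {e : Fin n → ℝ}
    {β S : Fin p → ℝ} (h : IsAugmentedSolution X grp w α lam (X *ᵥ β₀ + e) β S)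
    {Γ : Set (A → ℝ)} (hΓ : ∀ r ∈ Γ, ∀ j, 0 < r j) {N : Set (Fin p → ℝ)}
    (hN : N ⊆ subgradManifold X grp w α A) :
    ((fun j : A => blockNorm grp α β j) ∈ Γ ∧ S ∈ N ∧ activeGroups grp β = A) ↔
      ∃ r ∈ Γ, ∃ s ∈ N, mapHTilde X grp w α lam β₀ A r s = (1 / √(n : ℝ)) • e := by
  have hn' : (0 : ℝ) < √(n : ℝ) := Real.sqrt_pos.2 (by exact_mod_cast hn)
  constructor
  · rintro ⟨h1, h2, h3⟩
    exact ⟨_, h1, S, h2, mapHTilde_of_isAugmentedSolution hn hnp hX hα hw hlam h h3⟩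
  · rintro ⟨r, hr, s, hs, heq⟩
    have h1 := isAugmentedSolution_primal (β₀ := β₀) hn hnp hX hα hw hlam (hΓ r hr) (hN hs)
    rw [heq, smul_smul, mul_one_div_cancel hn'.ne', one_smul] at h1
    obtain ⟨rfl, rfl⟩ := h.unique hn hα hw hlam hpos h1
    have hs1 := (hN hs).2.1
    refine ⟨?_, hs, activeGroups_primal hα (hΓ r hr) hs1⟩
    convert hr using 1
    ext j
    rw [blockNorm_primal hα (hΓ r hr) hs1]
    simp [extendZero]

/-- The identification of `ℝⁿ` with the range of `(r_A, s_F)`. -/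
noncomputable def coordEquiv (A : Finset (Fin J)) (hA : A.card ≤ n) :
    (Fin n → ℝ) ≃L[ℝ] (A → ℝ) × (Fin (n - A.card) → ℝ) :=
  ((LinearEquiv.funCongrLeft ℝ ℝ (columnEquiv A hA).symm).trans
    (LinearEquiv.sumArrowLequivProdArrow A (Fin (n - A.card)) ℝ ℝ)).toContinuousLinearEquiv

theorem measurePreserving_coordEquiv (hA : A.card ≤ n) :
    MeasurePreserving (coordEquiv (n := n) A hA) volume volume :=
  (volume_measurePreserving_sumPiEquivProdPi fun _ : A ⊕ Fin (n - A.card) => ℝ).comp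
    (volume_measurePreserving_piCongrLeft (fun _ : Fin n => ℝ) (columnEquiv A hA).symm).symm

theorem measurableEmbedding_coordEquiv (hA : A.card ≤ n) :
    MeasurableEmbedding (coordEquiv (n := n) A hA) :=
  (coordEquiv A hA).toHomeomorph.measurableEmbedding

theorem sumElim_coordEquiv (hA : A.card ≤ n) (x : Fin n → ℝ) :
    Sum.elim (coordEquiv A hA x).1 (coordEquiv A hA x).2 = x ∘ (columnEquiv A hA).symm := by
  ext (j | l) <;> rfl

/-- The derivative of `mapHTilde` along a curve of subgradients with derivative `L`. -/
noncomputable def lawDeriv (X : Matrix (Fin n) (Fin p) ℝ) (grp : Fin p → Fin J) (w : Fin J → ℝ)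
    (α lam : ℝ) (A : Finset (Fin J)) (r : A → ℝ) (s : Fin p → ℝ)
    (L : (Fin (n - A.card) → ℝ) →L[ℝ] (Fin p → ℝ)) :
    (A → ℝ) × (Fin (n - A.card) → ℝ) →L[ℝ] (Fin n → ℝ) :=
  (√(n : ℝ) • (pinv Xᵀ).mulVecLin).toContinuousLinearMap ∘L
    (((gramEta X grp α s).submatrix id (Subtype.val : A → Fin J)).mulVecLin.toContinuousLinearMap
        ∘L ContinuousLinearMap.fst ℝ _ _ +
      (scaledGram X grp A r * derivMatrix grp α A s +
        lam • weightMatrix grp w).mulVecLin.toContinuousLinearMap ∘L L ∘L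
        ContinuousLinearMap.snd ℝ _ _)

theorem lawDeriv_apply (r : A → ℝ) (s : Fin p → ℝ)
    (L : (Fin (n - A.card) → ℝ) →L[ℝ] (Fin p → ℝ)) (b : (A → ℝ) × (Fin (n - A.card) → ℝ)) :
    lawDeriv X grp w α lam A r s L b = √(n : ℝ) • (pinv Xᵀ *ᵥ
      ((gramEta X grp α s).submatrix id (Subtype.val : A → Fin J) *ᵥ b.1 +
        (scaledGram X grp A r * derivMatrix grp α A s + lam • weightMatrix grp w) *ᵥ L b.2)) :=
  rfl

/-- The subset of `Δ` on which the entries of `Φ` that vanish are those in `Z`. -/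
def zeroPiece (Δ : Set (Fin (n - A.card) → ℝ)) (Φ : (Fin (n - A.card) → ℝ) → Fin p → ℝ)
    (Z : Finset (Fin p)) : Set (Fin (n - A.card) → ℝ) :=
  {u | u ∈ Δ ∧ ∀ k, Φ u k = 0 ↔ k ∈ Z}

theorem iUnion_zeroPiece (Δ : Set (Fin (n - A.card) → ℝ))
    (Φ : (Fin (n - A.card) → ℝ) → Fin p → ℝ) : ⋃ Z, zeroPiece Δ Φ Z = Δ := by
  classical
  ext u
  simp only [zeroPiece, Set.mem_iUnion, Set.mem_ofPred_eq]
  refine ⟨fun ⟨_, hu, _⟩ => hu, fun hu =>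
    ⟨Finset.univ.filter fun k => Φ u k = 0, hu, fun k => by simp⟩⟩

theorem disjoint_zeroPiece (Δ : Set (Fin (n - A.card) → ℝ))
    (Φ : (Fin (n - A.card) → ℝ) → Fin p → ℝ) {Z Z' : Finset (Fin p)} (hZ : Z ≠ Z') :
    Disjoint (zeroPiece Δ Φ Z) (zeroPiece Δ Φ Z') := by
  rw [Set.disjoint_left]
  rintro u ⟨-, h⟩ ⟨-, h'⟩
  exact hZ (Finset.ext fun k => (h k).symm.trans (h' k))

theorem measurableSet_zeroPiece {Δ : Set (Fin (n - A.card) → ℝ)}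
    {Φ : (Fin (n - A.card) → ℝ) → Fin p → ℝ} (hΔ : MeasurableSet Δ) (hΦ : ContinuousOn Φ Δ)
    (Z : Finset (Fin p)) : MeasurableSet (zeroPiece Δ Φ Z) := by
  have hm : ∀ k, MeasurableSet (Δ ∩ {u | Φ u k = 0}) := by
    intro k
    obtain ⟨t, ht, hteq⟩ := continuousOn_iff_isClosed.1
      ((continuous_apply k).comp_continuousOn hΦ) {0} isClosed_singleton
    have : Δ ∩ {u | Φ u k = 0} = t ∩ Δ := by
      rw [← hteq, Set.inter_comm]
      rfl
    rw [this]
    exact ht.measurableSet.inter hΔ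
  have : zeroPiece Δ Φ Z = Δ ∩ ⋂ k, {u | u ∈ Δ ∩ {u | Φ u k = 0} ↔ k ∈ Z} := by
    ext u
    simp only [zeroPiece, Set.mem_inter_iff, Set.mem_iInter, Set.mem_ofPred_eq]
    refine and_congr_right fun hu => ?_
    simp [hu]
  rw [this]
  refine hΔ.inter (MeasurableSet.iInter fun k => ?_)
  by_cases hk : k ∈ Z
  · simp only [hk, iff_true]
    exact hm k
  · simp only [hk, iff_false]
    exact (hm k).compl

/-- Where the zero set of `Φ` does not vary, `η ∘ Φ` is differentiable even if `η` is not
differentiable at `0`. -/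
theorem hasFDerivWithinAt_eta_comp {Δ : Set (Fin (n - A.card) → ℝ)}
    {Φ : (Fin (n - A.card) → ℝ) → Fin p → ℝ}
    {L : (Fin (n - A.card) → ℝ) →L[ℝ] (Fin p → ℝ)} {Z : Finset (Fin p)}
    {u : Fin (n - A.card) → ℝ} (hu : u ∈ zeroPiece Δ Φ Z)
    (hΦ : HasFDerivWithinAt Φ L (zeroPiece Δ Φ Z) u) (k : Fin p) :
    HasFDerivWithinAt (fun u => eta α (Φ u k))
      (etaDeriv α (Φ u k) • (ContinuousLinearMap.proj k ∘L L)) (zeroPiece Δ Φ Z) u := by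
  have hk : HasFDerivWithinAt (fun u => Φ u k) (ContinuousLinearMap.proj k ∘L L)
      (zeroPiece Δ Φ Z) u := hasFDerivWithinAt_pi'.1 hΦ k
  by_cases h0 : Φ u k = 0
  -- If ρ = 1, η is the identity. Otherwise `etaDeriv` is 0 at this entry, and the entry vanishes on
  -- the whole piece, so the composite is constant there.
  · by_cases hρ : rho α = 1
    · simp only [eta_of_rho_eq_one hρ, etaDeriv_of_rho_eq_one hρ, one_smul]
      exact hk
    · rw [h0, etaDeriv_zero hρ, zero_smul]
      have hkZ : k ∈ Z := (hu.2 k).1 h0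
      refine (hasFDerivWithinAt_const (0 : ℝ) u _).congr (fun v hv => ?_) ?_
      · rw [(hv.2 k).2 hkZ, eta_zero]
      · rw [h0, eta_zero]
  · exact (hasDerivAt_eta h0).comp_hasFDerivWithinAt u hk

theorem hasFDerivWithinAt_extendZero (j : Fin J)
    {s : Set ((A → ℝ) × (Fin (n - A.card) → ℝ))} (b : (A → ℝ) × (Fin (n - A.card) → ℝ)) :
    ∃ D : (A → ℝ) × (Fin (n - A.card) → ℝ) →L[ℝ] ℝ,
      HasFDerivWithinAt
        (fun b : (A → ℝ) × (Fin (n - A.card) → ℝ) => extendZero A b.1 j) D s b ∧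
      ∀ d, D d = extendZero A d.1 j := by
  unfold extendZero
  by_cases hj : j ∈ A
  · refine ⟨ContinuousLinearMap.proj ⟨j, hj⟩ ∘L ContinuousLinearMap.fst ℝ _ _, ?_, fun d => ?_⟩
    · simp only [hj, dite_true]
      exact (ContinuousLinearMap.proj (R := ℝ) (φ := fun _ : A => ℝ) ⟨j, hj⟩ ∘L
        ContinuousLinearMap.fst ℝ (A → ℝ) (Fin (n - A.card) → ℝ)).hasFDerivWithinAt
    · simp [hj]
  · refine ⟨0, ?_, fun d => ?_⟩
    · simp only [hj, dite_false]
      exact hasFDerivWithinAt_const _ _ _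
    · simp [hj]

theorem gramEta_mulVec (s : Fin p → ℝ) (r : A → ℝ) (i : Fin p) :
    ((gramEta X grp α s).submatrix id (Subtype.val : A → Fin J) *ᵥ r) i =
      ∑ k, gram X i k * (extendZero A r (grp k) * eta α (s k)) := by
  have h1 := congrFun (mapH_eq (X := X) (grp := grp) (w := 0) (α := α) (lam := 0) (β₀ := 0) r s) i
  have h2 : ((gramEta X grp α s).submatrix id (Subtype.val : A → Fin J) *ᵥ r) i =
      mapH X grp 0 α 0 0 A r s i := by
    simp [mapH, Matrix.mulVec, dotProduct, mul_comm]
  rw [h2, h1]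
  simp [Matrix.mulVec, dotProduct, primal]

theorem hasFDerivWithinAt_mapHTilde {Γ : Set (A → ℝ)} {Δ : Set (Fin (n - A.card) → ℝ)}
    {Φ : (Fin (n - A.card) → ℝ) → Fin p → ℝ}
    {L : (Fin (n - A.card) → ℝ) →L[ℝ] (Fin p → ℝ)} {Z : Finset (Fin p)}
    {b : (A → ℝ) × (Fin (n - A.card) → ℝ)} (hb : b ∈ Γ ×ˢ zeroPiece Δ Φ Z)
    (hΦ : HasFDerivWithinAt Φ L Δ b.2) :
    HasFDerivWithinAt (fun b : (A → ℝ) × (Fin (n - A.card) → ℝ) =>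
        mapHTilde X grp w α lam β₀ A b.1 (Φ b.2))
      (lawDeriv X grp w α lam A b.1 (Φ b.2) L) (Γ ×ˢ zeroPiece Δ Φ Z) b := by
  have hΦZ : HasFDerivWithinAt Φ L (zeroPiece Δ Φ Z) b.2 := hΦ.mono fun u hu => hu.1
  have hsnd : HasFDerivWithinAt (Prod.snd : (A → ℝ) × (Fin (n - A.card) → ℝ) → _)
      (ContinuousLinearMap.snd ℝ _ _) (Γ ×ˢ zeroPiece Δ Φ Z) b := hasFDerivWithinAt_snd
  have hmaps : Set.MapsTo (Prod.snd : (A → ℝ) × (Fin (n - A.card) → ℝ) → _)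
      (Γ ×ˢ zeroPiece Δ Φ Z) (zeroPiece Δ Φ Z) := fun c hc => hc.2
  have hη : ∀ k, HasFDerivWithinAt
      (fun b : (A → ℝ) × (Fin (n - A.card) → ℝ) => eta α (Φ b.2 k))
      ((etaDeriv α (Φ b.2 k) • (ContinuousLinearMap.proj k ∘L L)) ∘L
        ContinuousLinearMap.snd ℝ _ _) (Γ ×ˢ zeroPiece Δ Φ Z) b := fun k =>
    (hasFDerivWithinAt_eta_comp hb.2 hΦZ k).comp b hsnd hmaps
  have hs : ∀ k, HasFDerivWithinAt (fun b : (A → ℝ) × (Fin (n - A.card) → ℝ) => Φ b.2 k)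
      ((ContinuousLinearMap.proj k ∘L L) ∘L
        ContinuousLinearMap.snd ℝ _ _) (Γ ×ˢ zeroPiece Δ Φ Z) b := fun k =>
    (hasFDerivWithinAt_pi'.1 hΦZ k).comp b hsnd hmaps
  choose D hD hD' using fun k => hasFDerivWithinAt_extendZero (A := A) (grp k)
    (s := Γ ×ˢ zeroPiece Δ Φ Z) b
  have hH : HasFDerivWithinAt (fun b : (A → ℝ) × (Fin (n - A.card) → ℝ) =>
      mapH X grp w α lam β₀ A b.1 (Φ b.2))
      (((gramEta X grp α (Φ b.2)).submatrix id
        (Subtype.val : A → Fin J)).mulVecLin.toContinuousLinearMap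
        ∘L ContinuousLinearMap.fst ℝ _ _ +
      (scaledGram X grp A b.1 * derivMatrix grp α A (Φ b.2) +
        lam • weightMatrix grp w).mulVecLin.toContinuousLinearMap ∘L L ∘L
        ContinuousLinearMap.snd ℝ _ _) (Γ ×ˢ zeroPiece Δ Φ Z) b := by
    rw [hasFDerivWithinAt_pi']
    intro i
    have hi := ((HasFDerivWithinAt.fun_sum (u := Finset.univ) fun k _ =>
      ((hD k).mul (hη k)).const_mul (gram X i k)).add
        ((hs i).const_mul (lam * w (grp i)))).sub_const ((gram X *ᵥ β₀) i)
    refine (hi.congr_fderiv ?_).congr (fun c _ => ?_) ?_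
    · refine ContinuousLinearMap.ext fun d => ?_
      simp only [_root_.add_apply, _root_.sum_apply,
        _root_.smul_apply, ContinuousLinearMap.comp_apply,
        ContinuousLinearMap.proj_apply, hD', Matrix.mulVecLin_apply,
        LinearMap.coe_toContinuousLinearMap', Pi.add_apply, smul_eq_mul,
        ContinuousLinearMap.coe_fst', ContinuousLinearMap.coe_snd']
      rw [gramEta_mulVec, Matrix.add_mulVec, Pi.add_apply, ← add_assoc]
      congr 1
      · rw [← Matrix.mulVec_mulVec]
        simp_rw [Matrix.mulVec, dotProduct]
        rw [← Finset.sum_add_distrib]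
        refine Finset.sum_congr rfl fun k _ => ?_
        have hdk : (derivMatrix grp α A (Φ b.2) *ᵥ L d.2) k =
            (if grp k ∈ A then etaDeriv α (Φ b.2 k) else 0) * L d.2 k := by
          rw [derivMatrix, Matrix.mulVec_diagonal]
        rw [hdk, scaledGram, Matrix.of_apply]
        -- Outside A the factor r_j and its derivative vanish, which matches the zero entries of D.
        by_cases hk : grp k ∈ A
        · rw [if_pos hk]; ring
        · simp [extendZero, hk]
      · rw [Matrix.smul_mulVec, weightMatrix, Pi.smul_apply, Matrix.mulVec_diagonal, smul_eq_mul]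
        ring
    · rw [mapH_eq]
      simp [Matrix.mulVec, dotProduct, primal, weightMatrix, Matrix.diagonal_apply, mul_assoc]
    · rw [mapH_eq]
      simp [Matrix.mulVec, dotProduct, primal, weightMatrix, Matrix.diagonal_apply, mul_assoc]
  exact ((√(n : ℝ) • (pinv Xᵀ).mulVecLin).toContinuousLinearMap.hasFDerivAt).comp_hasFDerivWithinAt
    b hH

/-- Almost everywhere, the derivative of a parameterization maps into the tangent space. -/
theorem ae_mem_tangentSet (hnp : n ≤ p) (hX : ColumnsIndependent X) (hα : 1 < α)
    (hw : ∀ j, 0 < w j) {Δ : Set (Fin (n - A.card) → ℝ)}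
    {Φ : (Fin (n - A.card) → ℝ) → Fin p → ℝ}
    {Φ' : (Fin (n - A.card) → ℝ) → (Fin (n - A.card) → ℝ) →L[ℝ] (Fin p → ℝ)}
    (hΦ : IsParameterization X grp w α A Δ Φ Φ') :
    ∀ᵐ u ∂volume.restrict Δ, ∀ v, Φ' u v ∈ tangentSet X grp w α A (Φ u) := by
  obtain ⟨R, hR⟩ := LinearMap.exists_leftInverse_of_injective (subgradMap X grp w)
    (LinearMap.ker_eq_bot.2 (subgradMap_injective (grp := grp) hnp hX hw))
  -- A projection whose kernel is 𝒱: membership in 𝒱 becomes a set of equations constant along Φ, to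
  -- be differentiated like the norm constraints.
  let P : (Fin p → ℝ) →L[ℝ] (Fin p → ℝ) :=
    (LinearMap.id - subgradMap X grp w ∘ₗ R).toContinuousLinearMap
  have hP : ∀ s, s ∈ subgradSpace X grp w ↔ P s = 0 := by
    intro s
    change _ ↔ s - subgradMap X grp w (R s) = 0
    rw [mem_subgradSpace hw, sub_eq_zero]
    constructor
    · rintro ⟨z, rfl⟩
      rw [show R (subgradMap X grp w z) = z from congrArg (fun f => f z) hR]
    · exact fun h => ⟨_, h.symm⟩
  have h1 : ∀ i, ∀ᵐ u ∂volume.restrict Δ,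
      (ContinuousLinearMap.proj i ∘L P) ∘L Φ' u = 0 := by
    intro i
    refine ae_hasFDerivWithinAt_const_eq_zero (φ := fun u => P (Φ u) i) (c := 0) volume
      hΦ.measurableSet (fun u hu => ?_) fun u hu => ?_
    · rw [(hP _).1 (hΦ.mapsTo hu).1, Pi.zero_apply]
    · exact (ContinuousLinearMap.proj (R := ℝ) (φ := fun _ : Fin p => ℝ) i ∘L
        P).hasFDerivAt.comp_hasFDerivWithinAt u (hΦ.hasFDerivWithinAt u hu)
  have h2 : ∀ j : A, ∀ᵐ u ∂volume.restrict Δ,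
      ∑ k with grp k = j.1, (Real.conjExponent α * eta α (Φ u k)) •
        (ContinuousLinearMap.proj k ∘L Φ' u) = 0 := by
    intro j
    refine ae_hasFDerivWithinAt_const_eq_zero
      (φ := fun u => ∑ k with grp k = j.1, |Φ u k| ^ Real.conjExponent α) (c := 1) volume
      hΦ.measurableSet (fun u hu => ?_) fun u hu => ?_
    · exact (blockNorm_eq_one_iff (conjExponent_pos hα) _ _).1 ((hΦ.mapsTo hu).2.1 j j.2)
    · exact HasFDerivWithinAt.fun_sum fun k _ =>
        (hasDerivAt_abs_rpow_conjExponent hα _).comp_hasFDerivWithinAt u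
          (hasFDerivWithinAt_pi'.1 (hΦ.hasFDerivWithinAt u hu) k)
  filter_upwards [ae_all_iff.2 h1, ae_all_iff.2 h2] with u hu1 hu2 v
  refine ⟨(hP _).2 (funext fun i => congrArg (fun f => f v) (hu1 i)), fun j hj => ?_⟩
  have := congrArg (fun f => f v) (hu2 ⟨j, hj⟩)
  simp only [_root_.sum_apply, _root_.smul_apply,
    ContinuousLinearMap.comp_apply, ContinuousLinearMap.proj_apply, smul_eq_mul,
    _root_.zero_apply, mul_assoc, ← Finset.mul_sum] at this
  exact (mul_eq_zero.1 this).resolve_left (conjExponent_pos hα).ne'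

/-- Since L takes tangent values, L = T C with C = ∂s_F/∂u. The derivative matrix is therefore √n
(Xᵀ)⁺ M times the block diagonal matrix of 1 and C. Using one column enumeration on both factors
keeps the order irrelevant. -/
theorem abs_det_lawDeriv (hA : A.card ≤ n) (r : A → ℝ) {s : Fin p → ℝ}
    {L : (Fin (n - A.card) → ℝ) →L[ℝ] (Fin p → ℝ)} {F : Fin (n - A.card) ↪ Fin p}
    {T : Matrix (Fin p) (Fin (n - A.card)) ℝ} (hT : IsTangentMatrix X grp w α A s F T)
    (hL : ∀ v, L v ∈ tangentSet X grp w α A s) :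
    |(lawDeriv X grp w α lam A r s L ∘L
        (coordEquiv A hA : (Fin n → ℝ) →L[ℝ] (A → ℝ) × (Fin (n - A.card) → ℝ))).det| =
      absJacobian X grp w α lam A hA r s T * |coordJacobian F L| := by
  set C : Matrix (Fin (n - A.card)) (Fin (n - A.card)) ℝ :=
    (LinearMap.toMatrix' (L : (Fin (n - A.card) → ℝ) →ₗ[ℝ] (Fin p → ℝ))).submatrix F id with hC
  have hCv : ∀ v, T *ᵥ (C *ᵥ v) = L v := by
    intro v
    rw [hT.eq _ (hL v)]
    congr 1
    ext l
    change (LinearMap.toMatrix' (L : (Fin (n - A.card) → ℝ) →ₗ[ℝ] (Fin p → ℝ)) *ᵥ v) (F l) = _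
    rw [LinearMap.toMatrix'_mulVec]
    rfl
  have hmat : LinearMap.toMatrix' ((lawDeriv X grp w α lam A r s L ∘L
      (coordEquiv A hA : (Fin n → ℝ) →L[ℝ] (A → ℝ) × (Fin (n - A.card) → ℝ)) :
        (Fin n → ℝ) →L[ℝ] (Fin n → ℝ)) : (Fin n → ℝ) →ₗ[ℝ] (Fin n → ℝ)) =
      ((√(n : ℝ) • (pinv Xᵀ * matrixM X grp w α lam A r s T)).submatrix id (columnEquiv A hA)) *
        (Matrix.fromBlocks (1 : Matrix A A ℝ) 0 0 C).submatrix (columnEquiv A hA)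
          (columnEquiv A hA) := by
    refine Matrix.toLin'.injective (LinearMap.ext fun x => ?_)
    rw [Matrix.toLin'_toMatrix', Matrix.toLin'_apply, ← Matrix.mulVec_mulVec,
      Matrix.submatrix_mulVec_equiv, Matrix.submatrix_mulVec_equiv, ← sumElim_coordEquiv hA x,
      Function.comp_assoc, Equiv.self_comp_symm, Function.comp_id, Function.comp_id,
      Matrix.fromBlocks_mulVec, Matrix.smul_mulVec, ← Matrix.mulVec_mulVec, matrixM,
      Matrix.fromCols_mulVec]
    simp only [Sum.elim_comp_inl, Sum.elim_comp_inr, Matrix.one_mulVec, Matrix.zero_mulVec,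
      add_zero, zero_add, ← Matrix.mulVec_mulVec, hCv]
    exact lawDeriv_apply _ _ _ _
  rw [ContinuousLinearMap.det, ← LinearMap.det_toMatrix', hmat, Matrix.det_mul,
    Matrix.det_submatrix_equiv_self, Matrix.det_fromBlocks_zero₂₁, Matrix.det_one, one_mul,
    abs_mul]
  rfl

/-- The law of `H̃_A` on a piece of the sample space. -/
theorem withDensity_image_mapHTilde (hn : 0 < n) (hnp : n ≤ p) (hX : ColumnsIndependent X)
    (hα : 1 < α) (hw : ∀ j, 0 < w j) (hlam : 0 < lam)
    (hpos : BlockwiseGeneralPosition (X * (weightMatrix grp w)⁻¹) grp α)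
    {g : (Fin n → ℝ) → ℝ≥0∞} (hg : Measurable g) (hA : A.card ≤ n)
    {Γ : Set (A → ℝ)} (hΓ : MeasurableSet Γ) (hΓ0 : ∀ r ∈ Γ, ∀ j, 0 < r j)
    {Δ : Set (Fin (n - A.card) → ℝ)} {Φ : (Fin (n - A.card) → ℝ) → Fin p → ℝ}
    {Φ' : (Fin (n - A.card) → ℝ) → (Fin (n - A.card) → ℝ) →L[ℝ] (Fin p → ℝ)}
    (hΦ : IsParameterization X grp w α A Δ Φ Φ')
    {F : (Fin (n - A.card) → ℝ) → (Fin (n - A.card) ↪ Fin p)}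
    {T : (Fin (n - A.card) → ℝ) → Matrix (Fin p) (Fin (n - A.card)) ℝ}
    (hT : ∀ u ∈ Δ, IsTangentMatrix X grp w α A (Φ u) (F u) (T u)) :
    MeasurableSet ((fun b : (A → ℝ) × (Fin (n - A.card) → ℝ) =>
      mapHTilde X grp w α lam β₀ A b.1 (Φ b.2)) '' (Γ ×ˢ Δ)) ∧
    volume.withDensity g ((fun b : (A → ℝ) × (Fin (n - A.card) → ℝ) =>
      mapHTilde X grp w α lam β₀ A b.1 (Φ b.2)) '' (Γ ×ˢ Δ)) =
      ∫⁻ r in Γ, ∫⁻ u in Δ, density X grp w α lam β₀ g A hA r (Φ u) (T u) *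
        ENNReal.ofReal |coordJacobian (F u) (Φ' u)| := by
  let Q := coordEquiv (n := n) A hA
  let H : (A → ℝ) × (Fin (n - A.card) → ℝ) → Fin n → ℝ := fun b =>
    mapHTilde X grp w α lam β₀ A b.1 (Φ b.2)
  let H' : (A → ℝ) × (Fin (n - A.card) → ℝ) → (Fin n → ℝ) →L[ℝ] (Fin n → ℝ) := fun b =>
    lawDeriv X grp w α lam A b.1 (Φ b.2) (Φ' b.2) ∘L
      (Q : (Fin n → ℝ) →L[ℝ] (A → ℝ) × (Fin (n - A.card) → ℝ))
  -- The area formula is stated for maps of one space to itself, so the parameter space is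
  -- identified with ℝⁿ by the volume-preserving `Q`. The pieces are indexed by the zero set of Φ.
  let t : Finset (Fin p) → Set (Fin n → ℝ) := fun Z => Q ⁻¹' (Γ ×ˢ zeroPiece Δ Φ Z)
  have hQm := measurableEmbedding_coordEquiv (n := n) hA
  have hQp := measurePreserving_coordEquiv (n := n) hA
  have hcont : ContinuousOn Φ Δ := fun u hu => (hΦ.hasFDerivWithinAt u hu).continuousWithinAt
  have ht : ∀ Z, MeasurableSet (t Z) := fun Z =>
    hQm.measurable (hΓ.prod (measurableSet_zeroPiece hΦ.measurableSet hcont Z))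
  have htU : ⋃ Z, t Z = Q ⁻¹' (Γ ×ˢ Δ) := by
    rw [← Set.preimage_iUnion, ← Set.prod_iUnion, iUnion_zeroPiece]
  have hinj : Set.InjOn H (Γ ×ˢ Δ) := by
    rintro ⟨r, u⟩ ⟨hr, hu⟩ ⟨r', u'⟩ ⟨hr', hu'⟩ h
    obtain ⟨h1, h2⟩ := mapHTilde_injective hn hnp hX hα hw hlam hpos (hΓ0 r hr) (hΓ0 r' hr')
      (hΦ.mapsTo hu) (hΦ.mapsTo hu') h
    exact Prod.ext h1 (hΦ.injOn hu hu' h2)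
  obtain ⟨hmeas, haem, hint⟩ := lintegral_image_iUnion volume (f := H ∘ Q)
    (f' := fun x => H' (Q x)) ht
    (fun Z Z' hZ => (Set.Disjoint.set_prod_right (disjoint_zeroPiece Δ Φ hZ) Γ Γ).preimage Q)
    (fun Z x hx => (hasFDerivWithinAt_mapHTilde hx (hΦ.hasFDerivWithinAt _ hx.2.1)).comp x
      Q.hasFDerivAt.hasFDerivWithinAt fun y hy => hy)
    (by
      rw [htU]
      exact fun x hx y hy hxy => Q.injective (hinj hx hy hxy)) hg
  have himg : (H ∘ Q) '' ⋃ Z, t Z = H '' (Γ ×ˢ Δ) := by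
    rw [htU, Set.image_comp, Set.image_preimage_eq _ Q.surjective]
  rw [himg] at hmeas hint
  rw [htU] at haem hint
  refine ⟨hmeas, ?_⟩
  let f : (A → ℝ) × (Fin (n - A.card) → ℝ) → ℝ≥0∞ := fun b =>
    ENNReal.ofReal |(H' b).det| * g (H b)
  -- Tonelli's theorem is applied to this integrand, which involves neither F nor T; no
  -- measurability of the choice of coordinates is needed.
  have hf : AEMeasurable f ((volume.restrict Γ).prod (volume.restrict Δ)) := by
    rw [Measure.prod_restrict]
    exact ((hQp.restrict_preimage_emb hQm (Γ ×ˢ Δ)).aemeasurable_comp_iff hQm).1 haem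
  have hae := ae_mem_tangentSet hnp hX hα hw hΦ
  calc volume.withDensity g (H '' (Γ ×ˢ Δ))
      = ∫⁻ x in Q ⁻¹' (Γ ×ˢ Δ), f (Q x) := by rw [withDensity_apply _ hmeas, hint]; rfl
    _ = ∫⁻ b in Γ ×ˢ Δ, f b := hQp.setLIntegral_comp_preimage_emb hQm f _
    _ = ∫⁻ r in Γ, ∫⁻ u in Δ, f (r, u) := by
        rw [Measure.volume_eq_prod, ← Measure.prod_restrict, lintegral_prod _ hf]
    _ = _ := by
        refine lintegral_congr fun r => lintegral_congr_ae ?_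
        filter_upwards [hae, ae_restrict_mem hΦ.measurableSet] with u hu huΔ
        change ENNReal.ofReal |(H' (r, u)).det| * g (H (r, u)) = _
        rw [abs_det_lawDeriv hA r (hT u huΔ) hu, density,
          ENNReal.ofReal_mul (by exact abs_nonneg _), mul_comm, mul_assoc]

end Law

end BlockLasso

/-! ### The theorem: the law of ε/√n evaluated on images of H̃_A. -/

theorem theorem2 {n p J : ℕ} (hn : 0 < n) (hnp : n ≤ p)
    (X : Matrix (Fin n) (Fin p) ℝ) (grp : Fin p → Fin J) (w : Fin J → ℝ) (hw : ∀ j, 0 < w j)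
    (α : ℝ) (hα : 1 < α) (lam : ℝ) (hlam : 0 < lam) (β₀ : Fin p → ℝ)
    -- every `min n p` columns of `X` are independent
    (hX : BlockLasso.ColumnsIndependent X)
    -- the group sizes are at most `n`, and `X W⁻¹` is in blockwise general position
    (hsize : ∀ j : Fin J, (Finset.univ.filter fun k => grp k = j).card ≤ n)
    (hpos : BlockLasso.BlockwiseGeneralPosition
      (X * (BlockLasso.weightMatrix grp w)⁻¹) grp α)
    -- the error vector `ε`, and the density `g` of `ε / √n`
    {Ω : Type*} [MeasurableSpace Ω] (P : Measure Ω) [IsProbabilityMeasure P]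
    (ε : Ω → Fin n → ℝ) (hε : Measurable ε)
    (g : (Fin n → ℝ) → ℝ≥0∞) (hg : Measurable g)
    (hdens : P.map (fun ω => (1 / √(n : ℝ)) • ε ω) = volume.withDensity g) :
    -- for every response there is exactly one augmented solution
    (∀ y : Fin n → ℝ, ∃! b : (Fin p → ℝ) × (Fin p → ℝ),
      BlockLasso.IsAugmentedSolution X grp w α lam y b.1 b.2) ∧
    -- at each of its points, `M_A` is parameterized by some coordinates `s_F`
    (∀ (A : Finset (Fin J)), A.card ≤ n → ∀ s ∈ BlockLasso.subgradManifold X grp w α A,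
      ∃ (F : Fin (n - A.card) ↪ Fin p) (U : Set (Fin p → ℝ))
        (Δ : Set (Fin (n - A.card) → ℝ)) (Φ : (Fin (n - A.card) → ℝ) → Fin p → ℝ)
        (Φ' : (Fin (n - A.card) → ℝ) → (Fin (n - A.card) → ℝ) →L[ℝ] (Fin p → ℝ)),
        IsOpen U ∧ s ∈ U ∧ BlockLasso.IsParameterization X grp w α A Δ Φ Φ' ∧
        Φ '' Δ = BlockLasso.subgradManifold X grp w α A ∩ U ∧
        (∀ u ∈ Δ, ∀ l, Φ u (F l) = u l) ∧
        ∀ u ∈ Δ, ∃ T, BlockLasso.IsTangentMatrix X grp w α A (Φ u) F T) ∧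
    -- the augmented estimator `(βhat, S)` for the response `X β₀ + ε`
    ∀ βhat S : Ω → Fin p → ℝ,
      (∀ ω, BlockLasso.IsAugmentedSolution X grp w α lam (X *ᵥ β₀ + ε ω) (βhat ω) (S ω)) →
      Measurable βhat ∧ Measurable S ∧
      -- it takes its values in the sample space
      (∀ ω, (BlockLasso.activeGroups grp (βhat ω)).card ≤ n ∧
        S ω ∈ BlockLasso.subgradManifold X grp w α (BlockLasso.activeGroups grp (βhat ω))) ∧
      -- on each `Ω_A = (0, ∞)^A × M_A`, its law is the integral of the form `f_A dr_A ds_F`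
      ∀ (A : Finset (Fin J)) (hA : A.card ≤ n)
        (Γ : Set (A → ℝ)), MeasurableSet Γ → (∀ r ∈ Γ, ∀ j, 0 < r j) →
        ∀ (Δ : Set (Fin (n - A.card) → ℝ)) (Φ : (Fin (n - A.card) → ℝ) → Fin p → ℝ)
          (Φ' : (Fin (n - A.card) → ℝ) → (Fin (n - A.card) → ℝ) →L[ℝ] (Fin p → ℝ)),
        BlockLasso.IsParameterization X grp w α A Δ Φ Φ' →
        ∀ (F : (Fin (n - A.card) → ℝ) → (Fin (n - A.card) ↪ Fin p))
          (T : (Fin (n - A.card) → ℝ) → Matrix (Fin p) (Fin (n - A.card)) ℝ),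
        (∀ u ∈ Δ, BlockLasso.IsTangentMatrix X grp w α A (Φ u) (F u) (T u)) →
        P {ω | (fun j : A => BlockLasso.blockNorm grp α (βhat ω) j) ∈ Γ ∧ S ω ∈ Φ '' Δ ∧
            BlockLasso.activeGroups grp (βhat ω) = A} =
          ∫⁻ r in Γ, ∫⁻ u in Δ,
            BlockLasso.density X grp w α lam β₀ g A hA r (Φ u) (T u) *
              ENNReal.ofReal |BlockLasso.coordJacobian (F u) (Φ' u)| := by
  refine ⟨BlockLasso.existsUnique_isAugmentedSolution hn hα hw hlam hpos,
    fun A hA s hs => BlockLasso.exists_local_coordinates hnp hX hα hw hpos hA hs,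
    fun βhat S hsol => ?_⟩
  obtain ⟨hβ, hS⟩ := BlockLasso.measurable_estimator hn hα hw hlam hpos
    (hε.const_add (X *ᵥ β₀)) hsol
  refine ⟨hβ, hS, fun ω => (hsol ω).mem_sampleSpace hα hw hlam hpos, ?_⟩
  intro A hA Γ hΓ hΓ0 Δ Φ Φ' hΦ F T hT
  obtain ⟨hmeas, heq⟩ := BlockLasso.withDensity_image_mapHTilde (β₀ := β₀) hn hnp hX hα hw hlam
    hpos hg hA hΓ hΓ0 hΦ hT
  have hε' : Measurable fun ω => (1 / √(n : ℝ)) • ε ω :=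
    (measurable_const_smul (1 / √(n : ℝ))).comp hε
  rw [← heq, ← hdens, Measure.map_apply hε' hmeas]
  congr 1
  ext ω
  refine (BlockLasso.estimator_mem_iff hn hnp hX hα hw hlam hpos (hsol ω) hΓ0
    (Set.image_subset_iff.2 hΦ.mapsTo)).trans ?_
  constructor
  · rintro ⟨r, hr, _, ⟨u, hu, rfl⟩, h⟩
    exact ⟨(r, u), ⟨hr, hu⟩, h⟩
  · rintro ⟨⟨r, u⟩, ⟨hr, hu⟩, h⟩
    exact ⟨r, hr, _, ⟨u, hu, rfl⟩, h⟩
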